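/- **Setting.** For each number $m\ge 1$ of hypotheses let $n=n(m)\ge 1$ be a sample size with $\log m/n\to d$ as $m\to\infty$, where $0\le d<\infty$. Let $X_{i,j}\sim N(\mu_{m,i},1)$, $1\le i\le m$, $1\le j\le n$, be independent, and consider the hypotheses $H_i:\mu_{m,i}=0$. Let $I_{m,1}=\{i\le m:\mu_{m,i}\ne 0\}$ and assume $|I_{m,1}|\asymp m^{1-\epsilon}$ for some $0<\epsilon\le 1$. The hypothesis $H_1$ is false, with a mean $\mu_{m,1}=\mu_1\neq 0$ that does not depend on $m$. **Procedure.** Fix $0<\gamma\le 1$ and $0<\alpha<1$. Let $S_{n,i}=\sum_{j=1}^n X_{i,j}^2$ and $T_{n,i}=\sqrt n\,\overline X_{n,i}/\hat\sigma_{n,i}$, where $\overline X_{n,i}$ and $\hat\sigma_{n,i}^2$ are the mean and the unbiased variance of the $i$th sample. Write $\chi^2_n(p)$ and $t_{n-1}(p)$ for the $p$-quantiles of the chi-squared law with $n$ and of Student's law with $n-1$ degrees of freedom, with $\chi^2_n(0)=0$. The hypothesis $H_i$ is selected if $S_{n,i}>\chi^2_n(1-m^{\gamma-1})$; with $\hat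 S_n$ the set of selected indices, $H_i$ is rejected if it is selected and $|T_{n,i}|>t_{n-1}\bigl(1-\tfrac{\alpha}{2|\hat S_n|}\bigr)$. **Constant.** Let $g(x)=(e^x-1-x)/x^2$ for $x>0$ and $g(0)=\tfrac12$, an increasing bijection from $[0,\infty)$ onto $[\tfrac12,\infty)$, and let $a(c)=\bigl[g^{-1}(2/c^2)/c\bigr]^2$ for $0<c\le 2$. **Theorem.** The equation $a(c)=(1-\gamma)d$ has exactly one solution $c^*=c^*(\gamma,d)$ in $(0,2]$. Moreover: 1. If $\epsilon+\gamma\ge 1$ and $\mu_1^2>\max\bigl\{e^{2\gamma d}-1,\ 2(1-\gamma)d+c^*(\gamma,d)\sqrt{(1-\gamma)d}\bigr\}$, then $\lim_{m\to\infty}P\{H_1\text{ rejected}\}=1$. 2. If $\mu_1^2<\max\bigl\{e^{2\gamma d}-1,\ 2(1-\gamma)d+c^*(\gamma,d)\sqrt{(1-\gamma)d}\bigr\}$, then $\lim_{m\to\infty}P\{H_1\text{ rejected}\}=0$. -/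

import Mathlib

open MeasureTheory ProbabilityTheory Filter Topology Asymptotics

namespace TwoStage

noncomputable section

/-- The `p`-quantile of a law `ν` on the real line, the least `x` with `ν (-∞, x] ≥ p`.
For `p = 0` the set below is all of `ℝ` and the value is `0`, which for a chi-squared law is
the usual value, the lower end point of the support. -/
def quantile (ν : Measure ℝ) (p : ℝ) : ℝ :=
  sInf {x : ℝ | p ≤ cdf ν x}

/-- The chi-squared law with `k` degrees of freedom: the law of `Z₁² + ⋯ + Z_k²` for
independent standard normal variables `Z₁, …, Z_k`. -/
def chiSquared (k : ℕ) : Measure ℝ :=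
  (Measure.pi fun _ : Fin k => gaussianReal 0 1).map fun z => ∑ j, z j ^ 2

/-- Student's `t` law with `k` degrees of freedom: the law of `Z / √(V / k)` for independent
`Z ∼ N(0, 1)` and `V ∼ χ²_k`. -/
def studentT (k : ℕ) : Measure ℝ :=
  ((gaussianReal 0 1).prod (chiSquared k)).map fun p => p.1 / √(p.2 / k)

/-- The joint law of the data `X i j` (`i` runs over the `m` populations, `j` over the `n`
observations in a sample): all `X i j` are independent and `X i j ∼ N(μ i, 1)`. -/
def dataLaw {m : ℕ} (n : ℕ) (μ : Fin m → ℝ) : Measure (Fin m → Fin n → ℝ) :=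
  Measure.pi fun i => Measure.pi fun _ => gaussianReal (μ i) 1

/-- The sum of squares of a sample, the selection statistic. -/
def sumSq {n : ℕ} (x : Fin n → ℝ) : ℝ :=
  ∑ j, x j ^ 2

def sampleMean {n : ℕ} (x : Fin n → ℝ) : ℝ :=
  (∑ j, x j) / n

/-- The unbiased sample variance. -/
def sampleVar {n : ℕ} (x : Fin n → ℝ) : ℝ :=
  (∑ j, (x j - sampleMean x) ^ 2) / ((n : ℝ) - 1)

/-- The one-sample `t`-statistic. -/
def tStat {n : ℕ} (x : Fin n → ℝ) : ℝ :=
  √n * sampleMean x / √(sampleVar x)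

/-- The hypotheses selected in the first stage: those whose sum of squares exceeds the
`1 - m ^ (γ - 1)` quantile of `χ²_n`. -/
def selected {m n : ℕ} (γ : ℝ) (X : Fin m → Fin n → ℝ) : Finset (Fin m) :=
  {i | quantile (chiSquared n) (1 - (m : ℝ) ^ (γ - 1)) < sumSq (X i)}

/-- The two-stage procedure at level `α` rejects `H_i`: it is selected, and its two-sided
`t`-test, Bonferroni corrected for the number of selected hypotheses, rejects. -/
def Rejects {m n : ℕ} (γ α : ℝ) (X : Fin m → Fin n → ℝ) (i : Fin m) : Prop :=
  i ∈ selected γ X ∧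
    quantile (studentT (n - 1)) (1 - α / (2 * (selected γ X).card)) < |tStat (X i)|

/-- The probability that the two-stage procedure rejects `H_i` when the means are `μ`. -/
def rejectProb {m : ℕ} (n : ℕ) (μ : Fin m → ℝ) (γ α : ℝ) (i : Fin m) : ℝ :=
  (dataLaw n μ).real {X | Rejects γ α X i}

/-- `g x = (exp x - 1 - x) / x ^ 2`, extended to `x = 0` by continuity. It is an increasing
bijection from `[0, ∞)` onto `[1 / 2, ∞)`. -/
def g (x : ℝ) : ℝ :=
  if x = 0 then 1 / 2 else (Real.exp x - 1 - x) / x ^ 2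

/-- The inverse of `g` as a function on `[0, ∞)`. -/
def gInv (y : ℝ) : ℝ :=
  Function.invFunOn g (Set.Ici 0) y

/-- `a c = (g⁻¹ (2 / c ^ 2) / c) ^ 2`. It is meaningful for `0 < c ≤ 2`, where
`2 / c ^ 2 ≥ 1 / 2`, and it decreases there from `∞` to `a 2 = 0`. -/
def a (c : ℝ) : ℝ :=
  (gInv (2 / c ^ 2) / c) ^ 2

/-- `c*(γ, d)`, the solution in `(0, 2]` of `a c = (1 - γ) * d`. -/
def cStar (γ d : ℝ) : ℝ :=
  Function.invFunOn a (Set.Ioc 0 2) ((1 - γ) * d)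

/-- The detection boundary for the square of the mean. -/
def boundary (γ d : ℝ) : ℝ :=
  max (Real.exp (2 * γ * d) - 1) (2 * (1 - γ) * d + cStar γ d * √((1 - γ) * d))

end

end TwoStage

/-! Both critical values are large-deviation thresholds on the scale `log m ≈ n d`, and at the fixed
hypothesis both statistics obey a weak law: `sumSq / n → 1 + μ₁²` and `tStat² / n → μ₁²` in
probability.

Selection: the tail of `χ²_n` beyond `n (1 + δ)` is `exp (-n (δ - log (1 + δ)) / 2)` up to `exp
(o(n))`. The level `m ^ (γ - 1)` thus puts the threshold near `n (1 + δ)` with `δ - log (1 + δ) = 2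
(1 - γ) d`. Substituting `1 + δ = exp x` gives `exp x - 1 - x = 2 (1 - γ) d`, solved by `x = c* √((1
- γ) d)`; so `δ` is the second term of the boundary (`boundary_right_spec`).

Testing: the Student tail beyond `√n x` is `exp (-n log (1 + x²) / 2)` to the same accuracy. About
`m ^ γ` hypotheses are selected, so the squared critical value over `n` is near `exp (2 γ d) - 1`,
the first term. At most `m ^ κ` are selected for each `κ > γ` (Markov, using `ε + γ ≥ 1`), and at
least a multiple of `m ^ γ` (Chebyshev over the true hypotheses).

All tail estimates rest on one change of measure, `pi_gaussianReal_eq_withDensity`: the likelihood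
ratio of `N(0, v)` to `N(0, 1)` samples depends on `sumSq` alone. -/

namespace TwoStage

/-! ### The constant `c*` -/

/-- The coefficients are positive, so monotonicity and lower bounds for `g` on `[0, ∞)` can be read
off termwise. -/
theorem hasSum_g (x : ℝ) : HasSum (fun k : ℕ => x ^ k / (k + 2).factorial) (g x) := by
  by_cases hx : x = 0
  · subst hx
    have := hasSum_single (f := fun k : ℕ => (0 : ℝ) ^ k / (k + 2).factorial) 0
      (fun k hk => by simp [hk])
    simpa [g] using this
  · have h : HasSum (fun k : ℕ => x ^ k / k.factorial) (Real.exp x) := by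
      rw [Real.exp_eq_exp_ℝ]
      exact NormedSpace.expSeries_div_hasSum_exp x
    rw [← hasSum_nat_add_iff' 2] at h
    have h2 := h.div_const (x ^ 2)
    simp only [Finset.sum_range_succ, Finset.sum_range_zero] at h2
    have h3 : g x = (Real.exp x - (0 + x ^ 0 / (Nat.factorial 0 : ℝ) +
        x ^ 1 / (Nat.factorial 1 : ℝ))) / x ^ 2 := by
      simp [g, hx]
      ring
    have h4 : (fun k : ℕ => x ^ k / ((k + 2).factorial : ℝ)) =
        fun k : ℕ => x ^ (k + 2) / ((k + 2).factorial : ℝ) / x ^ 2 := by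
      funext k
      field_simp
      ring
    rw [h3, h4]
    exact h2

theorem g_strictMonoOn : StrictMonoOn g (Set.Ici 0) := by
  intro x hx y _ hxy
  have hx : 0 ≤ x := hx
  -- The zeroth term is the constant `1 / 2`; strictness comes from the linear term.
  refine hasSum_lt (i := 1) (fun k => ?_) ?_ (hasSum_g x) (hasSum_g y)
  · exact div_le_div_of_nonneg_right (pow_le_pow_left₀ hx hxy.le k) (by positivity)
  · simp only [pow_one]
    exact div_lt_div_of_pos_right hxy (by positivity)

theorem g_zero : g 0 = 1 / 2 := by simp [g]

theorem mul_sq_g {x : ℝ} : x ^ 2 * g x = Real.exp x - 1 - x := by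
  by_cases hx : x = 0
  · simp [hx]
  · simp only [g, hx, if_false]
    field_simp

theorem exists_exp_sub_eq {t : ℝ} (ht : 0 ≤ t) : ∃ x, 0 ≤ x ∧ Real.exp x - 1 - x = t := by
  have hc : ContinuousOn (fun x : ℝ => Real.exp x - 1 - x) (Set.Icc 0 (t + 2)) := by fun_prop
  have h := intermediate_value_Icc (by linarith : (0 : ℝ) ≤ t + 2) hc
  have hq := Real.quadratic_le_exp_of_nonneg (by linarith : 0 ≤ t + 2)
  obtain ⟨x, hx, hxt⟩ := h (show t ∈ _ from ⟨by simpa using ht, by nlinarith⟩)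
  exact ⟨x, hx.1, hxt⟩

theorem continuousOn_g : ContinuousOn g (Set.Ioi 0) := by
  have : ContinuousOn (fun x : ℝ => (Real.exp x - 1 - x) / x ^ 2) (Set.Ioi 0) := by
    refine ContinuousOn.div (by fun_prop) (by fun_prop) fun x hx => ?_
    have : (0 : ℝ) < x := hx
    positivity
  refine this.congr fun x hx => ?_
  simp [g, (ne_of_gt hx : x ≠ 0)]

/-- The intermediate value theorem on an interval away from `0`: the bound `1 / 2 + x` stands in for
continuity at `0`, and linear growth supplies the right end point. -/
theorem exists_g_eq {y : ℝ} (hy : 1 / 2 ≤ y) : ∃ x ∈ Set.Ici (0 : ℝ), g x = y := by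
  rcases hy.eq_or_lt with rfl | hy
  · exact ⟨0, by simp, g_zero⟩
  -- near zero `g x ≤ 1 / 2 + x`, and `g x ≥ x / 6`
  have hsmall : ∀ x, 0 < x → x ≤ 1 → g x ≤ 1 / 2 + x := by
    intro x hx hx1
    have h := Real.exp_bound' hx.le hx1 (n := 3) (by norm_num)
    have h2 := mul_sq_g (x := x)
    simp only [Finset.sum_range_succ, Finset.sum_range_zero, Nat.factorial] at h
    norm_num at h
    have h3 : x ^ 2 * g x ≤ x ^ 2 * (1 / 2 + x) := by
      rw [h2]
      nlinarith [pow_pos hx 3]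
    exact le_of_mul_le_mul_left h3 (by positivity)
  have hlarge : ∀ x, 0 < x → x / 6 ≤ g x := by
    intro x hx
    have h := sum_le_hasSum {1} (fun k _ => by positivity) (hasSum_g x)
    norm_num [Nat.factorial] at h
    exact h
  set u := min 1 (y - 1 / 2)
  have hu : 0 < u := lt_min one_pos (by linarith)
  have huy : u ≤ y - 1 / 2 := min_le_right _ _
  have hc : ContinuousOn g (Set.Icc u (6 * y + u)) :=
    continuousOn_g.mono fun x hx => lt_of_lt_of_le hu hx.1
  obtain ⟨x, hx, hxy⟩ := intermediate_value_Icc (by linarith) hc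
    (show y ∈ Set.Icc (g u) (g (6 * y + u)) from
      ⟨(hsmall u hu (min_le_left _ _)).trans (by linarith),
        le_trans (by linarith) (hlarge _ (by linarith))⟩)
  exact ⟨x, hu.le.trans hx.1, hxy⟩

theorem gInv_spec {y : ℝ} (hy : 1 / 2 ≤ y) : 0 ≤ gInv y ∧ g (gInv y) = y :=
  ⟨Function.invFunOn_mem (exists_g_eq hy), Function.invFunOn_eq (exists_g_eq hy)⟩

theorem half_le_two_div_sq {c : ℝ} (hc : c ∈ Set.Ioc (0 : ℝ) 2) : 1 / 2 ≤ 2 / c ^ 2 := by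
  have h0 := hc.1
  have h2 := hc.2
  rw [div_le_div_iff₀ (by norm_num) (by positivity)]
  nlinarith

/-- On `(0, 2]` the equation `a c = t` says that `x = c √t` solves `exp x - 1 - x = 2 t`. -/
theorem exp_sub_of_a_eq {c t : ℝ} (hc : c ∈ Set.Ioc (0 : ℝ) 2) (h : a c = t) :
    Real.exp (c * √t) - 1 - c * √t = 2 * t ∧ 2 / c ^ 2 = g (c * √t) := by
  have h0 := hc.1
  obtain ⟨hx, hg⟩ := gInv_spec (half_le_two_div_sq hc)
  have hs : √t = gInv (2 / c ^ 2) / c := by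
    rw [← h, a, Real.sqrt_sq (by positivity)]
  have hx2 : c * √t = gInv (2 / c ^ 2) := by rw [hs]; field_simp
  rw [hx2]
  refine ⟨?_, hg.symm⟩
  rw [← mul_sq_g, hg, ← h, a]
  field_simp

/-- For `t > 0` solve `exp x - 1 - x = 2 t` and put `c = x / √t`; then `2 / c² = 2 t / x² = g x`,
and `g x ≥ 1 / 2` is the condition `c ≤ 2`. For `t = 0` this degenerates and `c = 2`. -/
theorem exists_a_eq {t : ℝ} (ht : 0 ≤ t) : ∃ c ∈ Set.Ioc (0 : ℝ) 2, a c = t := by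
  rcases ht.eq_or_lt with rfl | ht
  · refine ⟨2, by simp, ?_⟩
    obtain ⟨hx, hg⟩ := gInv_spec (y := 2 / 2 ^ 2) (by norm_num)
    have : gInv (2 / 2 ^ 2) = 0 := by
      apply g_strictMonoOn.injOn hx (by simp)
      rw [hg, g_zero]; norm_num
    simp [a, this]
  obtain ⟨x, hx, hxt⟩ := exists_exp_sub_eq (t := 2 * t) (by linarith)
  have hx0 : 0 < x := by
    rcases hx.eq_or_lt with rfl | h
    · simp at hxt; linarith
    · exact h
  have hst := Real.sqrt_pos.2 ht
  have hgx : 2 / (x / √t) ^ 2 = g x := by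
    have := mul_sq_g (x := x)
    rw [div_pow, Real.sq_sqrt ht.le]
    field_simp
    linarith
  have hg2 : 1 / 2 ≤ g x := by
    rw [← g_zero]
    exact g_strictMonoOn.monotoneOn (by simp) hx hx
  refine ⟨x / √t, ⟨by positivity, ?_⟩, ?_⟩
  · rw [← hgx, div_le_div_iff₀ (by norm_num) (by positivity)] at hg2
    exact abs_le_of_sq_le_sq' (by linarith) (by norm_num) |>.2
  · obtain ⟨hy, hgy⟩ := gInv_spec hg2
    have : gInv (g x) = x := g_strictMonoOn.injOn hy hx hgy
    rw [a, hgx, this]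
    field_simp
    exact (Real.sq_sqrt ht.le).symm ▸ rfl

theorem exp_sub_injOn : Set.InjOn (fun x : ℝ => Real.exp x - 1 - x) (Set.Ici 0) := by
  have : StrictMonoOn (fun x : ℝ => x ^ 2 * g x) (Set.Ici 0) := by
    intro x hx y hy hxy
    have hx' : (0 : ℝ) ≤ x := hx
    have h1 := g_strictMonoOn hx hy hxy
    have h0 := g_strictMonoOn.monotoneOn (show (0 : ℝ) ∈ Set.Ici 0 by simp) hx hx'
    rw [g_zero] at h0
    have : x ^ 2 < y ^ 2 := by gcongr
    simp only
    nlinarith [sq_nonneg x]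
  simpa only [mul_sq_g] using this.injOn

/-- The common value `t` determines `x = c √t`, and then `2 / c² = g x` determines `c`. The second
relation is needed when `t = 0`, where `x = 0` for every `c`. -/
theorem a_injOn : Set.InjOn a (Set.Ioc 0 2) := by
  intro c hc c' hc' h
  obtain ⟨h1, h2⟩ := exp_sub_of_a_eq hc rfl
  obtain ⟨h3, h4⟩ := exp_sub_of_a_eq hc' h.symm
  have hc0 := hc.1
  have hc0' := hc'.1
  have h5 : c * √(a c) = c' * √(a c) :=
    exp_sub_injOn (Set.mem_Ici.2 (by positivity)) (Set.mem_Ici.2 (by positivity))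
      (h1.trans h3.symm)
  have h6 : 2 / c ^ 2 = 2 / c' ^ 2 := by rw [h2, h4, h5]
  rw [div_eq_div_iff (by positivity) (by positivity)] at h6
  exact (sq_eq_sq₀ hc0.le hc0'.le).1 (by linarith)

theorem cStar_spec {γ d : ℝ} (h : 0 ≤ (1 - γ) * d) :
    cStar γ d ∈ Set.Ioc (0 : ℝ) 2 ∧ a (cStar γ d) = (1 - γ) * d :=
  ⟨Function.invFunOn_mem (exists_a_eq h), Function.invFunOn_eq (exists_a_eq h)⟩

/-- The second term `δ` of the detection boundary is the nonnegative solution of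
`δ - log (1 + δ) = 2 (1 - γ) d`. -/
theorem boundary_right_spec {γ d : ℝ} (h : 0 ≤ (1 - γ) * d) :
    0 ≤ 2 * (1 - γ) * d + cStar γ d * √((1 - γ) * d) ∧
      2 * (1 - γ) * d + cStar γ d * √((1 - γ) * d) -
        Real.log (1 + (2 * (1 - γ) * d + cStar γ d * √((1 - γ) * d))) = 2 * ((1 - γ) * d) := by
  obtain ⟨hc, ha⟩ := cStar_spec h
  obtain ⟨h1, -⟩ := exp_sub_of_a_eq hc ha
  have hc0 := hc.1
  have h2 : 0 ≤ cStar γ d * √((1 - γ) * d) := by positivity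
  refine ⟨by linarith, ?_⟩
  have : 1 + (2 * (1 - γ) * d + cStar γ d * √((1 - γ) * d)) =
      Real.exp (cStar γ d * √((1 - γ) * d)) := by linarith
  rw [this, Real.log_exp]
  ring

/-! ### Product measures -/

section Pi

variable {ι : Type*} [Fintype ι] {Ω : ι → Type*} {mΩ : ∀ i, MeasurableSpace (Ω i)}
  {ν : (i : ι) → Measure (Ω i)} [∀ i, IsProbabilityMeasure (ν i)]

theorem lintegral_pi_prod {f : (i : ι) → Ω i → ENNReal} (hf : ∀ i, Measurable (f i)) :
    ∫⁻ x, ∏ i, f i (x i) ∂Measure.pi ν = ∏ i, ∫⁻ y, f i y ∂ν i := by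
  refine (lintegral_prod_eq_prod_lintegral_of_indepFun Finset.univ
    (fun i (x : (i : ι) → Ω i) => f i (x i))
    (iIndepFun_pi fun i => (hf i).aemeasurable)
    (fun i => (hf i).comp (measurable_pi_apply i))).trans ?_
  refine Finset.prod_congr rfl fun i _ => ?_
  exact (measurePreserving_eval ν i).lintegral_comp (hf i)

/-- Boxes determine a product measure, and on a box the density times the indicator is again a
product of functions of single coordinates. -/
theorem pi_withDensity {f : (i : ι) → Ω i → ENNReal} (hf : ∀ i, Measurable (f i))
    [∀ i, SigmaFinite ((ν i).withDensity (f i))] :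
    Measure.pi (fun i => (ν i).withDensity (f i)) =
      (Measure.pi ν).withDensity fun x => ∏ i, f i (x i) := by
  refine Measure.pi_eq fun s hs => ?_
  rw [withDensity_apply _ (MeasurableSet.univ_pi hs),
    ← lintegral_indicator (MeasurableSet.univ_pi hs)]
  have h := lintegral_pi_prod (ν := ν) (f := fun i => (s i).indicator (f i))
    fun i => (hf i).indicator (hs i)
  simp only [lintegral_indicator (hs _), ← withDensity_apply _ (hs _)] at h
  rw [← h]
  refine lintegral_congr fun x => ?_
  by_cases hx : x ∈ Set.univ.pi s
  · rw [Set.indicator_of_mem hx]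
    exact Finset.prod_congr rfl fun i _ => (Set.indicator_of_mem (hx i trivial) _).symm
  · rw [Set.indicator_of_notMem hx]
    obtain ⟨i, hi⟩ : ∃ i, x i ∉ s i := by simpa [Set.mem_pi] using hx
    exact (Finset.prod_eq_zero (Finset.mem_univ i) (Set.indicator_of_notMem hi _)).symm

/-- Chebyshev's inequality for a sum of functions of the coordinates. -/
theorem pi_chebyshev {f : (i : ι) → Ω i → ℝ} (hf : ∀ i, MemLp (f i) 2 (ν i)) {t : ℝ}
    (ht : 0 < t) :
    (Measure.pi ν).real {x | t ≤ |∑ i, f i (x i) - ∑ i, ∫ y, f i y ∂ν i|} ≤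
      (∑ i, Var[f i; ν i]) / t ^ 2 := by
  have hf' : ∀ i, MemLp (fun x : (i : ι) → Ω i => f i (x i)) 2 (Measure.pi ν) :=
    fun i => (hf i).comp_measurePreserving (measurePreserving_eval _ i)
  have hs : MemLp (∑ i, fun x : (i : ι) → Ω i => f i (x i)) 2 (Measure.pi ν) :=
    memLp_finsetSum' _ fun i _ => hf' i
  have h := meas_ge_le_variance_div_sq hs ht
  rw [variance_sum_pi hf] at h
  have hE : ∫ x, (∑ i, fun x : (i : ι) → Ω i => f i (x i)) x ∂Measure.pi ν =
      ∑ i, ∫ y, f i y ∂ν i := by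
    simp only [Finset.sum_apply]
    rw [integral_finsetSum _ fun i _ => (hf' i).integrable (by norm_num)]
    refine Finset.sum_congr rfl fun i _ => ?_
    exact integral_comp_eval (hf i).aestronglyMeasurable
  rw [hE] at h
  refine ENNReal.toReal_le_of_le_ofReal ?_ ?_
  · exact div_nonneg (Finset.sum_nonneg fun i _ => variance_nonneg _ _) (by positivity)
  · simpa only [Finset.sum_apply] using h

end Pi

/-- The weak law of large numbers with Chebyshev's rate, for a sample of a fixed law. -/
theorem pi_average_chebyshev {ν : Measure ℝ} [IsProbabilityMeasure ν] {f : ℝ → ℝ}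
    (hf : MemLp f 2 ν) {n : ℕ} (hn : 0 < n) {t : ℝ} (ht : 0 < t) :
    (Measure.pi fun _ : Fin n => ν).real {x | t ≤ |(∑ j, f (x j)) / n - ∫ y, f y ∂ν|} ≤
      Var[f; ν] / t ^ 2 / n := by
  have hn' : (0 : ℝ) < n := by exact_mod_cast hn
  have h := pi_chebyshev (ν := fun _ : Fin n => ν) (f := fun _ => f) (fun _ => hf)
    (mul_pos hn' ht)
  simp only [Finset.sum_const, Finset.card_univ, Fintype.card_fin, nsmul_eq_mul] at h
  have hv : n * Var[f; ν] / (n * t) ^ 2 = Var[f; ν] / t ^ 2 / n := by field_simp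
  rw [hv] at h
  convert h using 2
  · ext x
    have : (∑ j, f (x j)) / n - ∫ y, f y ∂ν = (∑ j, f (x j) - n * ∫ y, f y ∂ν) / n := by
      field_simp
    simp only [Set.mem_ofPred_eq]
    rw [this, abs_div, abs_of_pos hn', le_div_iff₀ hn', mul_comm]

theorem tendsto_pi_average {ν : Measure ℝ} [IsProbabilityMeasure ν] {f : ℝ → ℝ}
    (hf : MemLp f 2 ν) {t : ℝ} (ht : 0 < t) :
    Tendsto (fun n : ℕ => (Measure.pi fun _ : Fin n => ν).real
      {x | t ≤ |(∑ j, f (x j)) / n - ∫ y, f y ∂ν|}) atTop (𝓝 0) := by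
  refine squeeze_zero' (Eventually.of_forall fun n => measureReal_nonneg)
    ((eventually_gt_atTop 0).mono fun n hn => pi_average_chebyshev hf hn ht) ?_
  exact tendsto_const_nhds.div_atTop tendsto_natCast_atTop_atTop

/-! ### Gaussian samples -/

theorem memLp_sq_gaussianReal (μ : ℝ) (v : NNReal) :
    MemLp (fun x : ℝ => x ^ 2) 2 (gaussianReal μ v) := by
  have h := memLp_id_gaussianReal (μ := μ) (v := v) 4
  have h4 : MemLp (fun x : ℝ => x) 4 (gaussianReal μ v) := h
  have : ENNReal.HolderTriple 4 4 2 := ⟨by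
    rw [← two_mul]
    rw [show (4 : ENNReal) = 2 * 2 by norm_num, ENNReal.mul_inv (by simp) (by simp), ← mul_assoc,
      ENNReal.mul_inv_cancel (by simp) (by simp), one_mul]⟩
  have := h4.mul (r := 2) h4
  simpa [sq, Pi.mul_def] using this

theorem integral_sq_gaussianReal (μ : ℝ) (v : NNReal) :
    ∫ x, x ^ 2 ∂gaussianReal μ v = μ ^ 2 + v := by
  have h := variance_eq_sub (memLp_id_gaussianReal (μ := μ) (v := v) 2)
  rw [variance_id_gaussianReal] at h
  simp only [Pi.pow_apply, id] at h
  rw [integral_id_gaussianReal] at h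
  linarith

/-- The density of `N(0, v)` with respect to `N(0, 1)`. -/
noncomputable def tilt (v x : ℝ) : ℝ :=
  (√v)⁻¹ * Real.exp (-(1 / v - 1) * x ^ 2 / 2)

theorem gaussianReal_eq_withDensity_tilt {v : NNReal} (hv : v ≠ 0) :
    gaussianReal 0 v = (gaussianReal 0 1).withDensity fun x => ENNReal.ofReal (tilt v x) := by
  rw [gaussianReal_of_var_ne_zero _ hv, gaussianReal_of_var_ne_zero _ one_ne_zero,
    ← withDensity_mul _ (measurable_gaussianPDF _ _) (by unfold tilt; fun_prop)]
  congr 1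
  funext x
  simp only [Pi.mul_apply, gaussianPDF]
  rw [← ENNReal.ofReal_mul (gaussianPDFReal_nonneg _ _ _)]
  congr 1
  have hv' : (0 : ℝ) < v := by exact_mod_cast pos_iff_ne_zero.2 hv
  have : (√(2 * Real.pi * v))⁻¹ = (√(2 * Real.pi))⁻¹ * (√(v : ℝ))⁻¹ := by
    rw [Real.sqrt_mul (by positivity), mul_inv]
  simp only [gaussianPDFReal, tilt, NNReal.coe_one, mul_one, sub_zero]
  rw [this, mul_mul_mul_comm, ← Real.exp_add]
  congr 2
  field_simp
  ring

theorem prod_tilt {v : ℝ} (hv : 0 < v) {n : ℕ} (x : Fin n → ℝ) :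
    ∏ j, tilt v (x j) = Real.exp (-(n * Real.log v) / 2 - (1 / v - 1) * sumSq x / 2) := by
  simp only [tilt]
  have : (√v)⁻¹ = Real.exp (-(Real.log v) / 2) := by
    rw [Real.sqrt_eq_rpow, Real.rpow_def_of_pos hv, ← Real.exp_neg]
    congr 1; ring
  simp only [this, ← Real.exp_add, ← Real.exp_sum]
  congr 1
  rw [Finset.sum_add_distrib, sumSq]
  simp only [Finset.sum_const, Finset.card_univ, Fintype.card_fin, nsmul_eq_mul]
  rw [← Finset.sum_div, ← Finset.mul_sum]
  ring

theorem measurable_sumSq {n : ℕ} : Measurable (sumSq : (Fin n → ℝ) → ℝ) := by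
  unfold sumSq; fun_prop

/-- A change of variance in a centred Gaussian sample. -/
theorem pi_gaussianReal_eq_withDensity {v : NNReal} (hv : v ≠ 0) (n : ℕ) :
    (Measure.pi fun _ : Fin n => gaussianReal 0 v) =
      (Measure.pi fun _ : Fin n => gaussianReal 0 1).withDensity fun x =>
        ENNReal.ofReal (Real.exp (-(n * Real.log v) / 2 - (1 / v - 1) * sumSq x / 2)) := by
  have hs : IsProbabilityMeasure
      ((gaussianReal 0 1).withDensity fun x => ENNReal.ofReal (tilt v x)) := by
    rw [← gaussianReal_eq_withDensity_tilt hv]; infer_instance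
  have h := pi_withDensity (ν := fun _ : Fin n => gaussianReal 0 1)
    (f := fun _ x => ENNReal.ofReal (tilt v x)) (fun _ => by unfold tilt; fun_prop)
  simp only [← gaussianReal_eq_withDensity_tilt hv] at h
  rw [h]
  congr 1
  funext x
  rw [← prod_tilt (by exact_mod_cast pos_iff_ne_zero.2 hv),
    ENNReal.ofReal_prod_of_nonneg fun i _ => by unfold tilt; positivity]

/-! ### Tails of the chi-squared law -/

instance (k : ℕ) : IsProbabilityMeasure (chiSquared k) :=
  Measure.isProbabilityMeasure_map
    (Finset.measurable_fun_sum _ fun j _ => (measurable_pi_apply j).pow_const 2).aemeasurable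

theorem chiSquared_eq_map (k : ℕ) :
    chiSquared k = (Measure.pi fun _ : Fin k => gaussianReal 0 1).map sumSq := rfl

theorem chiSquared_real_apply (k : ℕ) {s : Set ℝ} (hs : MeasurableSet s) :
    (chiSquared k).real s =
      (Measure.pi fun _ : Fin k => gaussianReal 0 1).real (sumSq ⁻¹' s) := by
  rw [chiSquared_eq_map, map_measureReal_apply measurable_sumSq hs]

theorem sumSq_nonneg {n : ℕ} (x : Fin n → ℝ) : 0 ≤ sumSq x :=
  Finset.sum_nonneg fun _ _ => sq_nonneg _

theorem measurable_tilt_sumSq (v : ℝ) (n : ℕ) : Measurable fun x : Fin n → ℝ =>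
    ENNReal.ofReal (Real.exp (-(n * Real.log v) / 2 - (1 / v - 1) * sumSq x / 2)) := by
  unfold sumSq; fun_prop

/-- An upper bound for the likelihood ratio on `A` bounds the `N(0, 1)` probability of `A` from
below, which serves Cramér's bound; the reverse in `le_real_pi_gaussianReal` serves Chernoff's. -/
theorem real_pi_gaussianReal_le {v : NNReal} (hv : v ≠ 0) {n : ℕ} {A : Set (Fin n → ℝ)}
    (hA : MeasurableSet A) {c : ℝ} (h : ∀ x ∈ A,
      Real.exp (-(n * Real.log v) / 2 - (1 / v - 1) * sumSq x / 2) ≤ c) :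
    (Measure.pi fun _ : Fin n => gaussianReal 0 v).real A ≤
      c * (Measure.pi fun _ : Fin n => gaussianReal 0 1).real A := by
  rcases A.eq_empty_or_nonempty with rfl | ⟨x₀, hx₀⟩
  · simp
  have hc : 0 ≤ c := (Real.exp_nonneg _).trans (h x₀ hx₀)
  have h1 : (Measure.pi fun _ : Fin n => gaussianReal 0 v) A ≤
      ENNReal.ofReal c * (Measure.pi fun _ : Fin n => gaussianReal 0 1) A := by
    rw [pi_gaussianReal_eq_withDensity hv, withDensity_apply _ hA, ← setLIntegral_const]
    exact setLIntegral_mono measurable_const fun x hx => ENNReal.ofReal_le_ofReal (h x hx)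
  have h2 := ENNReal.toReal_mono (by finiteness) h1
  rwa [ENNReal.toReal_mul, ENNReal.toReal_ofReal hc] at h2

theorem le_real_pi_gaussianReal {v : NNReal} (hv : v ≠ 0) {n : ℕ} {A : Set (Fin n → ℝ)}
    (hA : MeasurableSet A) {c : ℝ} (hc : 0 ≤ c) (h : ∀ x ∈ A,
      c ≤ Real.exp (-(n * Real.log v) / 2 - (1 / v - 1) * sumSq x / 2)) :
    c * (Measure.pi fun _ : Fin n => gaussianReal 0 1).real A ≤
      (Measure.pi fun _ : Fin n => gaussianReal 0 v).real A := by
  have h1 : ENNReal.ofReal c * (Measure.pi fun _ : Fin n => gaussianReal 0 1) A ≤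
      (Measure.pi fun _ : Fin n => gaussianReal 0 v) A := by
    rw [pi_gaussianReal_eq_withDensity hv, withDensity_apply _ hA, ← setLIntegral_const]
    exact setLIntegral_mono (measurable_tilt_sumSq _ _)
      fun x hx => ENNReal.ofReal_le_ofReal (h x hx)
  have h2 := ENNReal.toReal_mono (by finiteness) h1
  rwa [ENNReal.toReal_mul, ENNReal.toReal_ofReal hc] at h2

/-- Chernoff's bound for the upper tail of the chi-squared law. -/
theorem chiSquared_Ioi_le {v : ℝ} (hv : 1 ≤ v) (n : ℕ) :
    (chiSquared n).real (Set.Ioi (n * v)) ≤ Real.exp (-(n * ((v - 1 - Real.log v) / 2))) := by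
  have hv0 : 0 < v := by linarith
  lift v to NNReal using hv0.le
  rw [chiSquared_real_apply n measurableSet_Ioi]
  -- Under variance `v` the threshold `n v` is the mean of `sumSq`. As `1 - 1 / v ≥ 0`, the
  -- likelihood ratio beyond it is at least its value there.
  have h := le_real_pi_gaussianReal (v := v) (n := n)
    (by exact_mod_cast hv0.ne') (measurable_sumSq measurableSet_Ioi)
    (c := Real.exp (n * ((v - 1 - Real.log v) / 2))) (A := sumSq ⁻¹' Set.Ioi (n * v))
    (Real.exp_nonneg _) fun x hx => by
      refine Real.exp_le_exp.2 ?_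
      have hx : n * v < sumSq x := hx
      have h1 : 0 ≤ 1 - 1 / (v : ℝ) := by
        rw [sub_nonneg, div_le_one hv0]; exact hv
      have h2 := mul_le_mul_of_nonneg_left hx.le h1
      have h3 : (1 - 1 / (v : ℝ)) * (n * v) = n * ((v : ℝ) - 1) := by field_simp
      linarith
  have h' := h.trans measureReal_le_one
  rw [Real.exp_neg, ← one_div, le_div_iff₀ (Real.exp_pos _)]
  linarith

/-- The Laplace transform of the chi-squared law. -/
theorem lintegral_exp_sumSq (x : ℝ) (n : ℕ) :
    ∫⁻ z, ENNReal.ofReal (Real.exp (-(x ^ 2 * sumSq z / 2)))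
        ∂(Measure.pi fun _ : Fin n => gaussianReal 0 1) =
      ENNReal.ofReal (Real.exp (-(n * (Real.log (1 + x ^ 2) / 2)))) := by
  have hp : 0 < 1 + x ^ 2 := by positivity
  -- For this variance `1 / v - 1 = x²`: up to a constant the integrand is a likelihood ratio, of
  -- integral one.
  have hv0 : 0 < (1 + x ^ 2)⁻¹ := by positivity
  obtain ⟨v, hv⟩ : ∃ v : NNReal, (v : ℝ) = (1 + x ^ 2)⁻¹ := ⟨⟨_, hv0.le⟩, rfl⟩
  rw [← hv] at hv0
  have h := pi_gaussianReal_eq_withDensity (v := v) (by exact_mod_cast hv0.ne') n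
  have h1 := congrArg (fun ρ => ρ Set.univ) h
  simp only [measure_univ, withDensity_apply _ MeasurableSet.univ, Measure.restrict_univ] at h1
  have h2 : ∀ z : Fin n → ℝ, ENNReal.ofReal (Real.exp (-(x ^ 2 * sumSq z / 2))) =
      ENNReal.ofReal (Real.exp (-(n * (Real.log (1 + x ^ 2) / 2)))) *
      ENNReal.ofReal (Real.exp (-(n * Real.log v) / 2 -
        (1 / (v : ℝ) - 1) * sumSq z / 2)) := by
    intro z
    rw [← ENNReal.ofReal_mul (Real.exp_nonneg _), ← Real.exp_add]
    congr 2
    rw [hv, Real.log_inv, one_div, inv_inv]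
    ring
  simp only [h2]
  rw [lintegral_const_mul _ (measurable_tilt_sumSq _ _)]
  rw [← h1, mul_one]

theorem eventually_exp_le_half {e : ℝ} (he : 0 < e) :
    ∀ᶠ n : ℕ in atTop, Real.exp (-(n * e)) ≤ 1 / 2 := by
  have : Tendsto (fun n : ℕ => Real.exp (-(n * e))) atTop (𝓝 0) :=
    Real.tendsto_exp_neg_atTop_nhds_zero.comp
      (tendsto_natCast_atTop_atTop.atTop_mul_const he)
  exact this.eventually_le_const (by norm_num)

/-- Cramér's lower bound for the chi-squared law near `n v`. -/
theorem eventually_le_chiSquared_ball {v : ℝ} (hv : 0 < v) {r : ℝ}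
    (hr : (v - 1 - Real.log v) / 2 < r) {θ : ℝ} (hθ : 0 < θ) :
    ∀ᶠ n : ℕ in atTop,
      Real.exp (-(n * r)) ≤ (chiSquared n).real {s | |s - n * v| < n * θ} := by
  lift v to NNReal using hv.le
  set e := r - (v - 1 - Real.log v) / 2 with he_def
  have he : 0 < e := by linarith
  -- a radius that costs at most half of the margin
  obtain ⟨η, hη, hηθ, hηe⟩ : ∃ η, 0 < η ∧ η ≤ θ ∧ |1 / (v : ℝ) - 1| * η / 2 ≤ e / 2 := by
    refine ⟨min θ (e / (|1 / (v : ℝ) - 1| + 1)), lt_min hθ (by positivity), min_le_left _ _, ?_⟩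
    have h1 : min θ (e / (|1 / (v : ℝ) - 1| + 1)) ≤ e / (|1 / (v : ℝ) - 1| + 1) := min_le_right _ _
    have h2 : |1 / (v : ℝ) - 1| * min θ (e / (|1 / (v : ℝ) - 1| + 1)) ≤
        (|1 / (v : ℝ) - 1| + 1) * (e / (|1 / (v : ℝ) - 1| + 1)) := by
      apply mul_le_mul (by linarith) h1 (le_min hθ.le (by positivity)) (by positivity)
    rw [mul_div_cancel₀ _ (by positivity)] at h2
    linarith
  have hv0 : v ≠ 0 := by exact_mod_cast hv.ne'
  have hL := tendsto_pi_average (memLp_sq_gaussianReal 0 v) hη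
  rw [integral_sq_gaussianReal] at hL
  filter_upwards [hL.eventually_le_const (show (0 : ℝ) < 1 / 2 by norm_num),
    eventually_exp_le_half (half_pos he), eventually_gt_atTop 0] with n h1 h2 hn
  have hn' : (0 : ℝ) < n := by exact_mod_cast hn
  have hA : MeasurableSet {x : Fin n → ℝ | |sumSq x - n * v| < n * η} :=
    measurableSet_lt ((measurable_sumSq.sub measurable_const).abs) measurable_const
  -- Under `N(0, v)` the ball is typical, by the law of large numbers.
  have hmass : 1 / 2 ≤ (Measure.pi fun _ : Fin n => gaussianReal 0 v).real
      {x : Fin n → ℝ | |sumSq x - n * v| < n * η} := by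
    have h3 := probReal_compl_eq_one_sub (μ := Measure.pi fun _ : Fin n =>
      gaussianReal 0 v) hA
    have h4 : {x : Fin n → ℝ | |sumSq x - n * v| < n * η}ᶜ =
        {x | η ≤ |(∑ j, x j ^ 2) / n - (0 ^ 2 + (v : ℝ))|} := by
      ext x
      simp only [Set.mem_compl_iff, Set.mem_ofPred_eq]
      rw [show ∑ j, x j ^ 2 = sumSq x from rfl]
      have : sumSq x / n - (0 ^ 2 + v) = (sumSq x - n * v) / n := by field_simp; ring
      rw [not_lt, this, abs_div, abs_of_pos hn', le_div_iff₀ hn', mul_comm]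
    rw [h4] at h3
    linarith
  have hd := real_pi_gaussianReal_le hv0 hA
    (c := Real.exp (n * ((v - 1 - Real.log v) / 2 + e / 2))) fun x hx => by
      refine Real.exp_le_exp.2 ?_
      have hx : |sumSq x - n * v| < n * η := hx
      have h3 : -((1 / (v : ℝ) - 1) * (sumSq x - n * v)) ≤ |1 / (v : ℝ) - 1| * (n * η) := by
        refine (neg_le_abs _).trans ?_
        rw [abs_mul]
        gcongr
      have h4 : (1 / (v : ℝ) - 1) * (n * v) = n * (1 - (v : ℝ)) := by field_simp
      have h5 : n * (|1 / (v : ℝ) - 1| * η / 2) ≤ n * (e / 2) := by gcongr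
      linarith
  have hmono : (Measure.pi fun _ : Fin n => gaussianReal 0 1).real
      {x : Fin n → ℝ | |sumSq x - n * v| < n * η} ≤
      (chiSquared n).real {s | |s - n * v| < n * θ} := by
    rw [chiSquared_real_apply n (measurableSet_lt (by fun_prop) (by fun_prop))]
    refine measureReal_mono fun x hx => ?_
    have hx : |sumSq x - n * v| < n * η := hx
    change |sumSq x - n * v| < n * θ
    exact hx.trans_le (by gcongr)
  refine le_trans ?_ hmono
  have h6 := hmass.trans hd
  -- One half of the margin `e` paid for the radius `η`; the other absorbs the factor `1 / 2`.
  have h7 : Real.exp (-(n * r)) = Real.exp (-(n * (e / 2))) *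
      (Real.exp (n * ((v - 1 - Real.log v) / 2 + e / 2)))⁻¹ := by
    rw [← Real.exp_neg, ← Real.exp_add]
    congr 1
    rw [he_def]; ring
  rw [h7, ← div_eq_mul_inv, div_le_iff₀ (Real.exp_pos _)]
  linarith

/-- By continuity the rate is still below `r` at some `w > v`, and the ball about `n w` of radius `n
(w - v)` lies in the tail. -/
theorem eventually_le_chiSquared_Ioi {v : ℝ} (hv : 0 < v) {r : ℝ}
    (hr : (v - 1 - Real.log v) / 2 < r) :
    ∀ᶠ n : ℕ in atTop, Real.exp (-(n * r)) ≤ (chiSquared n).real (Set.Ioi (n * v)) := by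
  have hc : ContinuousAt (fun w : ℝ => (w - 1 - Real.log w) / 2) v := by
    have := Real.continuousAt_log hv.ne'
    fun_prop
  have h1 : ∀ᶠ w in 𝓝[>] v, (w - 1 - Real.log w) / 2 < r :=
    (hc.eventually_lt_const hr).filter_mono nhdsWithin_le_nhds
  obtain ⟨w, hwr, hw⟩ := (h1.and self_mem_nhdsWithin).exists
  have hw : v < w := hw
  filter_upwards [eventually_le_chiSquared_ball (hv.trans hw) hwr (sub_pos.2 hw)] with n hn
  refine hn.trans (measureReal_mono fun s hs => ?_)
  have hs : |s - n * w| < n * (w - v) := hs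
  have := (abs_lt.1 hs).1
  change n * v < s
  linarith

/-! ### Tails of Student's law -/

theorem measurable_student (k : ℕ) :
    Measurable fun p : ℝ × ℝ => p.1 / √(p.2 / k) := by fun_prop

instance (k : ℕ) : IsProbabilityMeasure (studentT k) :=
  Measure.isProbabilityMeasure_map (measurable_student k).aemeasurable

theorem gaussianReal_Ici_le {s : ℝ} (hs : 0 ≤ s) :
    (gaussianReal 0 1) (Set.Ici s) ≤ ENNReal.ofReal (Real.exp (-(s ^ 2 / 2))) := by
  have h := measure_ge_le_exp_mul_mgf (μ := gaussianReal 0 1) (X := id) (t := s) s hs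
    (by simpa using integrable_exp_mul_gaussianReal s)
  rw [mgf_gaussianReal (by simp : (gaussianReal 0 1).map id = gaussianReal 0 1),
    ← Real.exp_add] at h
  rw [← ofReal_measureReal]
  refine ENNReal.ofReal_le_ofReal ?_
  have h' : (gaussianReal 0 1).real (Set.Ici s) ≤ _ := h
  refine h'.trans_eq ?_
  rw [NNReal.coe_one]
  congr 1
  ring

/-- On `(s, s + 1]` the density is at least its value at `s + 1`. For `s` of order `√k` the shift
costs only `O(√k)` in the exponent. -/
theorem le_gaussianReal_Ioi {s : ℝ} (hs : 0 ≤ s) :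
    (√(2 * Real.pi))⁻¹ * Real.exp (-((s + 1) ^ 2 / 2)) ≤
      (gaussianReal 0 1).real (Set.Ioi s) := by
  have h : ENNReal.ofReal ((√(2 * Real.pi))⁻¹ * Real.exp (-((s + 1) ^ 2 / 2))) ≤
      (gaussianReal 0 1) (Set.Ioc s (s + 1)) := by
    rw [gaussianReal_apply _ one_ne_zero]
    have h1 : ∫⁻ _ in Set.Ioc s (s + 1),
        ENNReal.ofReal ((√(2 * Real.pi))⁻¹ * Real.exp (-((s + 1) ^ 2 / 2))) ≤
        ∫⁻ x in Set.Ioc s (s + 1), gaussianPDF 0 1 x := by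
      refine setLIntegral_mono (measurable_gaussianPDF _ _) fun x hx => ?_
      refine ENNReal.ofReal_le_ofReal ?_
      simp only [gaussianPDFReal, NNReal.coe_one, mul_one, sub_zero]
      gcongr
      have := hx.1
      have := hx.2
      rw [neg_div, neg_le_neg_iff]
      gcongr
      linarith
    rw [setLIntegral_const, Real.volume_Ioc] at h1
    simpa using h1
  have h2 := h.trans (measure_mono (Set.Ioc_subset_Ioi_self))
  exact (ENNReal.ofReal_le_iff_le_toReal (by finiteness)).1 h2

/-- Given `V = s`, Gaussian Chernoff bounds the tail by `exp (-(k + 1) x² s / (2 k)) ≤ exp (-x² s /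
2)`; averaging over `s` gives the Laplace transform of `χ²_k`. The factor `√(k + 1)` is `√n` when `k
= n - 1`. -/
theorem studentT_Ioi_le {k : ℕ} (hk : 0 < k) {x : ℝ} (hx : 0 ≤ x) :
    (studentT k).real (Set.Ioi (√(k + 1) * x)) ≤
      Real.exp (-(k * (Real.log (1 + x ^ 2) / 2))) := by
  have hk' : (0 : ℝ) < k := by exact_mod_cast hk
  set y := √(k + 1) * x with hy_def
  have hy : 0 ≤ y := by positivity
  have hy2 : y ^ 2 = (k + 1) * x ^ 2 := by
    rw [hy_def, mul_pow, Real.sq_sqrt (by positivity)]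
  have hm : MeasurableSet ((fun p : ℝ × ℝ => p.1 / √(p.2 / k)) ⁻¹' Set.Ioi y) :=
    measurable_student k measurableSet_Ioi
  have key : studentT k (Set.Ioi y) ≤
      ENNReal.ofReal (Real.exp (-(k * (Real.log (1 + x ^ 2) / 2)))) := by
    rw [studentT, Measure.map_apply (measurable_student k) measurableSet_Ioi,
      Measure.prod_apply_symm hm, chiSquared_eq_map, lintegral_map
        (measurable_measure_prodMk_right hm) measurable_sumSq, ← lintegral_exp_sumSq]
    refine lintegral_mono fun z => ?_
    have hS := sumSq_nonneg z
    have hsq : √(sumSq z / k) ^ 2 = sumSq z / k := Real.sq_sqrt (by positivity)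
    refine (measure_mono (t := Set.Ici (y * √(sumSq z / k))) fun w hw => ?_).trans
      ((gaussianReal_Ici_le (by positivity)).trans ?_)
    · have hw : y < w / √(sumSq z / k) := hw
      rcases (Real.sqrt_nonneg (sumSq z / k)).eq_or_lt with h0 | h0
      -- At `V = 0` the quotient is `0` by convention, which does not exceed `y ≥ 0`.
      · rw [← h0, div_zero] at hw
        linarith
      · exact ((lt_div_iff₀ h0).1 hw).le
    · refine ENNReal.ofReal_le_ofReal (Real.exp_le_exp.2 (neg_le_neg ?_))
      rw [mul_pow, hsq, hy2]
      gcongr ?_ / 2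
      have : (k + 1) * x ^ 2 * (sumSq z / k) = x ^ 2 * sumSq z + x ^ 2 * sumSq z / k := by
        field_simp
      rw [this]
      linarith [show 0 ≤ x ^ 2 * sumSq z / k by positivity]
  exact ENNReal.toReal_le_of_le_ofReal (Real.exp_nonneg _) key

theorem eventually_sq_sqrt_add_le (C c e : ℝ) (he : 0 < e) :
    ∀ᶠ k : ℕ in atTop, (√(k + 1) * C + 1) ^ 2 / 2 + c ≤ k * (C ^ 2 / 2 + e) := by
  have h1 : Tendsto (fun k : ℕ => √((k : ℝ) + 1)) atTop atTop :=
    Real.tendsto_sqrt_atTop.comp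
      (tendsto_atTop_add_const_right _ 1 tendsto_natCast_atTop_atTop)
  have h2 : Tendsto (fun u : ℝ => u * (u * e - C)) atTop atTop :=
    tendsto_id.atTop_mul_atTop₀
      (tendsto_atTop_add_const_right _ (-C) (tendsto_id.atTop_mul_const he))
  filter_upwards [(h2.comp h1).eventually_ge_atTop (C ^ 2 / 2 + 1 / 2 + c + e)] with k hk
  simp only [Function.comp] at hk
  have h3 : √((k : ℝ) + 1) ^ 2 = k + 1 := Real.sq_sqrt (by positivity)
  have h4 : (√((k : ℝ) + 1) * C + 1) ^ 2 = (k + 1) * C ^ 2 + 2 * √((k : ℝ) + 1) * C + 1 := by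
    linear_combination C ^ 2 * h3
  have h5 : √((k : ℝ) + 1) * (√((k : ℝ) + 1) * e - C) = (k + 1) * e - √((k : ℝ) + 1) * C := by
    linear_combination e * h3
  rw [h4]
  rw [h5] at hk
  linarith

/-- Let `V` be near `k v` and let `Z` exceed `√(k + 1) x √v`. The cost per degree of freedom, `(v -
1 - log v) / 2 + x² v / 2`, is least at `v = 1 / (1 + x²)`, with value `log (1 + x²) / 2`. -/
theorem eventually_le_studentT_Ioi {x : ℝ} (hx : 0 ≤ x) {r : ℝ}
    (hr : Real.log (1 + x ^ 2) / 2 < r) :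
    ∀ᶠ k : ℕ in atTop, Real.exp (-(k * r)) ≤ (studentT k).real (Set.Ioi (√(k + 1) * x)) := by
  have hp : 0 < 1 + x ^ 2 := by positivity
  set v := (1 + x ^ 2)⁻¹ with hv_def
  have hv : 0 < v := by positivity
  have hxv : x ^ 2 * v = 1 - v := by rw [hv_def]; field_simp; ring
  have hlog : Real.log v = -Real.log (1 + x ^ 2) := Real.log_inv _
  -- One third each for the chi-squared ball, the Gaussian tail and the width `θ`.
  set e := (r - Real.log (1 + x ^ 2) / 2) / 3 with he_def
  have he : 0 < e := by
    have : 0 < r - Real.log (1 + x ^ 2) / 2 := by linarith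
    positivity
  obtain ⟨θ, hθ, hθv, hθe⟩ : ∃ θ, 0 < θ ∧ θ < v ∧ x ^ 2 * θ / 2 ≤ e := by
    refine ⟨min (v / 2) (e / (x ^ 2 + 1)), lt_min (by positivity) (by positivity),
      (min_le_left _ _).trans_lt (by linarith), ?_⟩
    have h1 : x ^ 2 * min (v / 2) (e / (x ^ 2 + 1)) ≤ (x ^ 2 + 1) * (e / (x ^ 2 + 1)) :=
      mul_le_mul (by linarith) (min_le_right _ _) (le_min (by positivity) (by positivity))
        (by positivity)
    rw [mul_div_cancel₀ _ (by positivity)] at h1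
    linarith
  -- `Z` must pass the threshold for every `V` in the ball, hence for the largest.
  set C := x * √(v + θ) with hC_def
  have hC2 : C ^ 2 = x ^ 2 * (v + θ) := by
    rw [hC_def, mul_pow, Real.sq_sqrt (by positivity)]
  filter_upwards [eventually_le_chiSquared_ball hv
      (lt_add_of_pos_right ((v - 1 - Real.log v) / 2) he) hθ,
    eventually_sq_sqrt_add_le C (Real.log (√(2 * Real.pi))) e he,
    eventually_gt_atTop 0] with k h1 h2 hk
  have hk' : (0 : ℝ) < k := by exact_mod_cast hk
  have h3 := le_gaussianReal_Ioi (s := √(k + 1) * C) (by positivity)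
  have hsub : Set.Ioi (√(k + 1) * C) ×ˢ {s : ℝ | |s - k * v| < k * θ} ⊆
      (fun p : ℝ × ℝ => p.1 / √(p.2 / k)) ⁻¹' Set.Ioi (√(k + 1) * x) := by
    rintro ⟨z, s⟩ ⟨hz, hs⟩
    have hz : √(k + 1) * C < z := hz
    have hs : |s - k * v| < k * θ := hs
    obtain ⟨hs1, hs2⟩ := abs_lt.1 hs
    have hs0 : 0 < s := by nlinarith
    change √(k + 1) * x < z / √(s / k)
    rw [lt_div_iff₀ (by positivity)]
    refine lt_of_le_of_lt ?_ hz
    rw [hC_def, ← mul_assoc]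
    gcongr
    rw [div_le_iff₀ hk']
    linarith
  have h4 : (gaussianReal 0 1).real (Set.Ioi (√(k + 1) * C)) *
      (chiSquared k).real {s : ℝ | |s - k * v| < k * θ} ≤
      (studentT k).real (Set.Ioi (√(k + 1) * x)) := by
    rw [studentT, map_measureReal_apply (measurable_student k) measurableSet_Ioi,
      ← measureReal_prod_prod]
    exact measureReal_mono hsub
  refine le_trans ?_ h4
  refine le_trans ?_ (mul_le_mul h3 h1 (Real.exp_nonneg _) measureReal_nonneg)
  have hpi : (√(2 * Real.pi))⁻¹ = Real.exp (-Real.log (√(2 * Real.pi))) := by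
    rw [Real.exp_neg, Real.exp_log (by positivity)]
  rw [hpi, ← Real.exp_add, ← Real.exp_add]
  refine Real.exp_le_exp.2 ?_
  have h5 : k * (x ^ 2 * θ / 2) ≤ k * e := by gcongr
  have h6 : k * (C ^ 2 / 2 + e) = k * (1 - v) / 2 + k * (x ^ 2 * θ / 2) + k * e := by
    rw [hC2, ← hxv]; ring
  have h7 : k * r = 3 * (k * e) + k * (Real.log (1 + x ^ 2) / 2) := by rw [he_def]; ring
  rw [hlog]
  linarith

/-! ### Quantiles -/

section Quantile

variable {ν : Measure ℝ}

theorem cdf_eq_one_sub [IsProbabilityMeasure ν] (y : ℝ) : cdf ν y = 1 - ν.real (Set.Ioi y) := by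
  rw [cdf_eq_real, ← Set.compl_Iic, probReal_compl_eq_one_sub measurableSet_Iic]
  ring

theorem bddBelow_quantile_set {p : ℝ} (hp : 0 < p) : BddBelow {x : ℝ | p ≤ cdf ν x} := by
  obtain ⟨b, hb⟩ := ((tendsto_cdf_atBot ν).eventually_lt_const hp).exists
  refine ⟨b, fun x hx => ?_⟩
  by_contra h
  have hx : p ≤ cdf ν x := hx
  linarith [monotone_cdf ν (not_le.1 h).le]

theorem nonempty_quantile_set {p : ℝ} (hp : p < 1) : {x : ℝ | p ≤ cdf ν x}.Nonempty :=
  ((tendsto_cdf_atTop ν).eventually_const_le hp).exists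

theorem quantile_of_nonpos {p : ℝ} (hp : p ≤ 0) : quantile ν p = 0 := by
  have : {x : ℝ | p ≤ cdf ν x} = Set.univ :=
    Set.eq_univ_of_forall fun x => hp.trans (cdf_nonneg ν x)
  rw [quantile, this, Real.sInf_univ]

theorem quantile_le [IsProbabilityMeasure ν] {p y : ℝ} (hy : 0 ≤ y) (h : ν.real (Set.Ioi y) ≤ 1 - p) :
    quantile ν p ≤ y := by
  rcases le_or_gt p 0 with hp | hp
  -- Here the quantile is the default value `0`, which is why `0 ≤ y` is assumed.
  · rwa [quantile_of_nonpos hp]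
  · refine csInf_le (bddBelow_quantile_set hp) ?_
    change p ≤ cdf ν y
    rw [cdf_eq_one_sub]
    linarith

theorem le_quantile [IsProbabilityMeasure ν] {p y : ℝ} (hp : p < 1) (h : 1 - p < ν.real (Set.Ioi y)) :
    y ≤ quantile ν p := by
  refine le_csInf (nonempty_quantile_set hp) fun x hx => ?_
  by_contra hxy
  have hx : p ≤ cdf ν x := hx
  have := monotone_cdf ν (not_le.1 hxy).le
  rw [cdf_eq_one_sub y] at this
  linarith

theorem real_Ioi_quantile_le [IsProbabilityMeasure ν] {p : ℝ} (hp : p < 1) :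
    ν.real (Set.Ioi (quantile ν p)) ≤ 1 - p := by
  rcases le_or_gt p 0 with hp0 | hp0
  · exact measureReal_le_one.trans (by linarith)
  · have h : p ≤ cdf ν (quantile ν p) := by
      have hc := (cdf ν).right_continuous (quantile ν p)
      have hc' : Tendsto (cdf ν) (𝓝[>] (quantile ν p)) (𝓝 (cdf ν (quantile ν p))) :=
        hc.mono_left (nhdsWithin_mono _ Set.Ioi_subset_Ici_self)
      refine ge_of_tendsto hc' (eventually_nhdsWithin_of_forall fun x hx => ?_)
      obtain ⟨y, hy, hyx⟩ := exists_lt_of_csInf_lt (nonempty_quantile_set hp) hx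
      exact le_trans hy (monotone_cdf ν hyx.le)
    rw [cdf_eq_one_sub] at h
    linarith

/-- Without atoms the cdf at the quantile equals its left limit, which is at most `p`. For `p = 0`,
the case `γ = 1`, the quantile is `0` and `hν` takes over. -/
theorem le_real_Ioi_quantile [IsProbabilityMeasure ν] [NullSingletonClass ν] (hν : ν.real (Set.Ioi 0) = 1) {p : ℝ} (hp : 0 ≤ p) :
    1 - p ≤ ν.real (Set.Ioi (quantile ν p)) := by
  rcases hp.eq_or_lt with rfl | hp
  · rw [quantile_of_nonpos le_rfl, hν]
    simp
  · have h1 := (cdf ν).measure_singleton (quantile ν p)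
    rw [measure_cdf, measure_singleton, eq_comm, ENNReal.ofReal_eq_zero] at h1
    have h2 : Function.leftLim (cdf ν) (quantile ν p) ≤ p := by
      refine le_of_tendsto ((monotone_cdf ν).tendsto_leftLim _)
        (eventually_nhdsWithin_of_forall fun x hx => ?_)
      by_contra hpx
      exact absurd (csInf_le (bddBelow_quantile_set hp) (not_le.1 hpx).le) (not_le.2 hx)
    have h3 := cdf_eq_one_sub (ν := ν) (quantile ν p)
    linarith

end Quantile

/-- By Fubini: with the other coordinates fixed, the first is confined to two points. For `k = 0`
the law is a point mass. -/
theorem nullSingletonClass_chiSquared {k : ℕ} (hk : 0 < k) : NullSingletonClass (chiSquared k) := by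
  obtain ⟨k, rfl⟩ := Nat.exists_eq_succ_of_ne_zero hk.ne'
  refine ⟨fun r => ?_⟩
  have hg : NullSingletonClass (gaussianReal 0 1) := nullSingletonClass_gaussianReal one_ne_zero
  rw [chiSquared_eq_map, Measure.map_apply measurable_sumSq (measurableSet_singleton r)]
  have hmp := measurePreserving_piFinSuccAbove (fun _ : Fin (k + 1) => gaussianReal 0 1) 0
  have hB : MeasurableSet {p : ℝ × (Fin k → ℝ) | p.1 ^ 2 + sumSq p.2 = r} :=
    measurableSet_eq_fun ((measurable_fst.pow_const 2).add
      (measurable_sumSq.comp measurable_snd)) measurable_const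
  have hA : sumSq ⁻¹' {r} = MeasurableEquiv.piFinSuccAbove (fun _ : Fin (k + 1) => ℝ) 0 ⁻¹'
      {p : ℝ × (Fin k → ℝ) | p.1 ^ 2 + sumSq p.2 = r} := by
    ext x
    simp [sumSq, Fin.sum_univ_succ, MeasurableEquiv.piFinSuccAbove, Fin.tail]
  rw [hA, hmp.measure_preimage hB.nullMeasurableSet, Measure.prod_apply_symm hB,
    lintegral_eq_zero_iff (measurable_measure_prodMk_right hB)]
  refine Eventually.of_forall fun w => ?_
  refine measure_mono_null (t := {√(r - sumSq w), -√(r - sumSq w)}) (fun z hz => ?_)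
    ((Set.toFinite _).measure_zero _)
  have hz : z ^ 2 + sumSq w = r := hz
  have h2 : √(r - sumSq w) = |z| := by
    rw [← Real.sqrt_sq_eq_abs]; congr 1; linarith
  rw [h2]
  rcases abs_choice z with h | h <;> rw [h] <;> simp

theorem chiSquared_real_Ioi_zero {k : ℕ} (hk : 0 < k) :
    (chiSquared k).real (Set.Ioi 0) = 1 := by
  have := nullSingletonClass_chiSquared hk
  rw [measureReal_congr Ioi_ae_eq_Ici, chiSquared_real_apply k measurableSet_Ici]
  have : (sumSq ⁻¹' Set.Ici 0 : Set (Fin k → ℝ)) = Set.univ :=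
    Set.eq_univ_of_forall fun x => sumSq_nonneg x
  rw [this, probReal_univ]

/-! ### Consistency of the statistics -/

theorem tendsto_sumSq (μ : ℝ) {U : Set ℝ} (hU : U ∈ 𝓝 (1 + μ ^ 2)) :
    Tendsto (fun n : ℕ => (Measure.pi fun _ : Fin n => gaussianReal μ 1).real
      {x | sumSq x / n ∉ U}) atTop (𝓝 0) := by
  obtain ⟨t, ht, htU⟩ := Metric.mem_nhds_iff.1 hU
  have h := tendsto_pi_average (memLp_sq_gaussianReal μ 1) ht
  rw [integral_sq_gaussianReal] at h
  refine squeeze_zero (fun n => measureReal_nonneg) (fun n => measureReal_mono fun x hx => ?_) h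
  by_contra hx'
  refine hx (htU ?_)
  have hx' : ¬ (t ≤ |sumSq x / n - (μ ^ 2 + (1 : NNReal))|) := hx'
  rw [Metric.mem_ball, Real.dist_eq]
  rw [NNReal.coe_one, add_comm (μ ^ 2)] at hx'
  exact not_le.1 hx'

theorem tendsto_sampleMean (μ : ℝ) {t : ℝ} (ht : 0 < t) :
    Tendsto (fun n : ℕ => (Measure.pi fun _ : Fin n => gaussianReal μ 1).real
      {x | t ≤ |sampleMean x - μ|}) atTop (𝓝 0) := by
  have h := tendsto_pi_average (memLp_id_gaussianReal (μ := μ) (v := 1) 2) ht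
  simpa only [id, integral_id_gaussianReal, sampleMean] using h

theorem sampleVar_eq {n : ℕ} (hn : 0 < n) (x : Fin n → ℝ) :
    sampleVar x = n / ((n : ℝ) - 1) * (sumSq x / n - sampleMean x ^ 2) := by
  have hn' : (0 : ℝ) < n := by exact_mod_cast hn
  have h1 : ∑ j, x j = n * sampleMean x := by rw [sampleMean]; field_simp
  have h2 : ∑ j, (x j - sampleMean x) ^ 2 = sumSq x - n * sampleMean x ^ 2 := by
    simp only [sub_sq, Finset.sum_add_distrib, Finset.sum_sub_distrib, ← Finset.mul_sum,
      ← Finset.sum_mul, h1, sumSq]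
    simp
    ring
  rw [sampleVar, h2]
  field_simp

theorem tStat_sq_div {n : ℕ} (hn : 1 < n) (x : Fin n → ℝ) :
    tStat x ^ 2 / n =
      sampleMean x ^ 2 / (n / ((n : ℝ) - 1) * (sumSq x / n - sampleMean x ^ 2)) := by
  have hn' : (1 : ℝ) < n := by exact_mod_cast hn
  have hv : 0 ≤ sampleVar x :=
    div_nonneg (Finset.sum_nonneg fun _ _ => sq_nonneg _) (by linarith)
  rw [← sampleVar_eq (by omega), tStat, div_pow, mul_pow, Real.sq_sqrt hv,
    Real.sq_sqrt (by linarith)]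
  field_simp

theorem tendsto_natCast_div_sub_one :
    Tendsto (fun n : ℕ => (n : ℝ) / ((n : ℝ) - 1)) atTop (𝓝 1) := by
  have h : Tendsto (fun n : ℕ => (1 - (n : ℝ)⁻¹)⁻¹) atTop (𝓝 ((1 - 0)⁻¹)) :=
    (tendsto_const_nhds.sub tendsto_inv_atTop_nhds_zero_nat).inv₀ (by norm_num)
  rw [sub_zero, inv_one] at h
  refine h.congr' ?_
  filter_upwards [eventually_gt_atTop 1] with n hn
  have hn' : (1 : ℝ) < n := by exact_mod_cast hn
  have : (n : ℝ) - 1 ≠ 0 := by linarith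
  field_simp

/-- The squared `t`-statistic divided by the sample size tends to `μ²` in probability. -/
theorem tendsto_tStat (μ : ℝ) {U : Set ℝ} (hU : U ∈ 𝓝 (μ ^ 2)) :
    Tendsto (fun n : ℕ => (Measure.pi fun _ : Fin n => gaussianReal μ 1).real
      {x | tStat x ^ 2 / n ∉ U}) atTop (𝓝 0) := by
  -- By `tStat_sq_div` the statistic is this function of the sample mean, the mean square and `n /
  -- (n - 1)`; its denominator is `1` at the limit point.
  have hc : ContinuousAt (fun p : ℝ × ℝ × ℝ => p.1 ^ 2 / (p.2.2 * (p.2.1 - p.1 ^ 2)))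
      (μ, 1 + μ ^ 2, 1) := by
    refine ContinuousAt.div (by fun_prop) (by fun_prop) ?_
    simp
  have hU' : ∀ᶠ p in 𝓝 ((μ, 1 + μ ^ 2, 1) : ℝ × ℝ × ℝ),
      p.1 ^ 2 / (p.2.2 * (p.2.1 - p.1 ^ 2)) ∈ U := by
    apply hc
    simpa using hU
  obtain ⟨t, ht, htU⟩ := Metric.eventually_nhds_iff.1 hU'
  have hs := tendsto_sumSq μ (Metric.ball_mem_nhds (1 + μ ^ 2) ht)
  have hsum := (tendsto_sampleMean μ ht).add hs
  rw [add_zero] at hsum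
  refine squeeze_zero' (Eventually.of_forall fun n => measureReal_nonneg) ?_ hsum
  filter_upwards [tendsto_natCast_div_sub_one.eventually (Metric.ball_mem_nhds 1 ht),
    eventually_gt_atTop 1] with n hn hn1
  refine le_trans (measureReal_mono fun x hx => ?_) (measureReal_union_le _ _)
  by_contra hx'
  have hx1 : ¬ (t ≤ |sampleMean x - μ|) := fun h => hx' (Or.inl h)
  have hx2 : sumSq x / n ∈ Metric.ball (1 + μ ^ 2) t := by
    by_contra h
    exact hx' (Or.inr h)
  refine hx ?_
  rw [tStat_sq_div hn1]
  refine htU (y := (sampleMean x, sumSq x / n, n / ((n : ℝ) - 1))) ?_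
  rw [Prod.dist_eq, Prod.dist_eq]
  exact max_lt (by rw [Real.dist_eq]; exact not_le.1 hx1) (max_lt hx2 hn)

/-! ### The number of selected hypotheses -/

section Count

variable {m n : ℕ} (μ : Fin m → ℝ) (q : ℝ)

instance (n : ℕ) : IsProbabilityMeasure (dataLaw n μ) := by
  unfold dataLaw; infer_instance

theorem dataLaw_real_row (i : Fin m) {s : Set (Fin n → ℝ)} (hs : MeasurableSet s) :
    (dataLaw n μ).real {X | X i ∈ s} = (Measure.pi fun _ => gaussianReal (μ i) 1).real s := by
  have h := measurePreserving_eval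
    (fun i => Measure.pi fun _ : Fin n => gaussianReal (μ i) 1) i
  exact congrArg ENNReal.toReal (h.measure_preimage hs.nullMeasurableSet)

/-- The inequality holds for arbitrary sets, so events of the `t`-statistic need no measurability
proof. -/
theorem dataLaw_real_row_le (i : Fin m) (s : Set (Fin n → ℝ)) :
    (dataLaw n μ).real {X | X i ∈ s} ≤
      (Measure.pi fun _ => gaussianReal (μ i) 1).real s := by
  have h := measurePreserving_eval
    (fun i => Measure.pi fun _ : Fin n => gaussianReal (μ i) 1) i
  have h2 := Measure.le_map_apply (h.measurable.aemeasurable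
    (μ := Measure.pi fun i => Measure.pi fun _ : Fin n => gaussianReal (μ i) 1)) s
  rw [h.map_eq] at h2
  exact ENNReal.toReal_mono (by finiteness) h2

theorem measurableSet_lt_sumSq : MeasurableSet {x : Fin n → ℝ | q < sumSq x} :=
  measurableSet_lt measurable_const measurable_sumSq

theorem dataLaw_real_lt_sumSq_of_eq_zero {i : Fin m} (hi : μ i = 0) :
    (dataLaw n μ).real {X | q < sumSq (X i)} = (chiSquared n).real (Set.Ioi q) := by
  rw [chiSquared_real_apply n measurableSet_Ioi]
  refine (dataLaw_real_row μ i (measurableSet_lt_sumSq q)).trans ?_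
  rw [hi]
  rfl

/-- Markov's inequality, with each false hypothesis counted as if always selected. -/
theorem dataLaw_card_le {K : ℝ} (hK : 0 < K) :
    (dataLaw n μ).real {X | K ≤ (({i | q < sumSq (X i)} : Finset (Fin m)).card : ℝ)} ≤
      (m * (chiSquared n).real (Set.Ioi q) +
        (({i | μ i ≠ 0} : Finset (Fin m)).card : ℝ)) / K := by
  have hm : ∀ i : Fin m, MeasurableSet {X : Fin m → Fin n → ℝ | q < sumSq (X i)} :=
    fun i => measurableSet_lt measurable_const (measurable_sumSq.comp (measurable_pi_apply i))
  have hcard : ∀ X : Fin m → Fin n → ℝ, (({i | q < sumSq (X i)} : Finset (Fin m)).card : ℝ) =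
      ∑ i, {X : Fin m → Fin n → ℝ | q < sumSq (X i)}.indicator 1 X := by
    intro X
    rw [Finset.card_filter]
    push_cast
    refine Finset.sum_congr rfl fun i _ => ?_
    simp [Set.indicator_apply]
  have hint : ∀ i ∈ Finset.univ, Integrable
      ({X : Fin m → Fin n → ℝ | q < sumSq (X i)}.indicator (1 : (Fin m → Fin n → ℝ) → ℝ))
      (dataLaw n μ) := fun i _ => (integrable_const 1).indicator (hm i)
  have h := mul_meas_ge_le_integral_of_nonneg (μ := dataLaw n μ)
    (f := fun X => ∑ i, {X : Fin m → Fin n → ℝ | q < sumSq (X i)}.indicator 1 X)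
    (Eventually.of_forall fun X => Finset.sum_nonneg fun i _ =>
      Set.indicator_nonneg (fun _ _ => zero_le_one) X)
    (integrable_finsetSum _ hint) K
  rw [integral_finsetSum _ hint] at h
  simp only [← hcard, integral_indicator_one (hm _)] at h
  rw [le_div_iff₀ hK, mul_comm]
  refine h.trans ?_
  have hp : 0 ≤ (chiSquared n).real (Set.Ioi q) := measureReal_nonneg
  calc ∑ i, (dataLaw n μ).real {X | q < sumSq (X i)}
      ≤ ∑ i, ((chiSquared n).real (Set.Ioi q) + if μ i ≠ 0 then 1 else 0) := by
        refine Finset.sum_le_sum fun i _ => ?_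
        by_cases hi : μ i = 0
        · simp [dataLaw_real_lt_sumSq_of_eq_zero μ q hi, hi]
        · simp only [ne_eq, hi, not_false_eq_true, if_true]
          linarith [measureReal_le_one (μ := dataLaw n μ) (s := {X | q < sumSq (X i)})]
    _ = _ := by
        rw [Finset.sum_add_distrib, Finset.card_filter]
        simp

/-- Chebyshev's inequality over the true hypotheses alone: an indicator has variance at most its
mean, which gives `E / (E / 2)² = 4 / E`. -/
theorem dataLaw_card_ge (hpos : 0 < (({i | μ i = 0} : Finset (Fin m)).card : ℝ) *
      (chiSquared n).real (Set.Ioi q)) :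
    (dataLaw n μ).real {X | (({i | q < sumSq (X i)} : Finset (Fin m)).card : ℝ) ≤
      (({i | μ i = 0} : Finset (Fin m)).card : ℝ) * (chiSquared n).real (Set.Ioi q) / 2} ≤
      4 / ((({i | μ i = 0} : Finset (Fin m)).card : ℝ) *
        (chiSquared n).real (Set.Ioi q)) := by
  set p := (chiSquared n).real (Set.Ioi q) with hp_def
  set E := (({i | μ i = 0} : Finset (Fin m)).card : ℝ) * p with hE_def
  set A := {x : Fin n → ℝ | q < sumSq x} with hA_def
  have hA : MeasurableSet A := measurableSet_lt_sumSq q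
  set f : Fin m → (Fin n → ℝ) → ℝ := fun i => if μ i = 0 then A.indicator 1 else 0 with hf_def
  have hfL : ∀ i, MemLp (f i) 2 (Measure.pi fun _ : Fin n => gaussianReal (μ i) 1) := by
    intro i
    by_cases hi : μ i = 0
    · simp only [hf_def, hi, if_true]
      exact (memLp_const 1).indicator hA
    · simp only [hf_def, hi, if_false]
      exact MemLp.zero
  have hfI : ∀ i, ∫ x, f i x ∂(Measure.pi fun _ : Fin n => gaussianReal (μ i) 1) =
      if μ i = 0 then p else 0 := by
    intro i
    by_cases hi : μ i = 0
    · simp only [hf_def, hi, if_true, integral_indicator_one hA]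
      rw [hp_def, chiSquared_real_apply n measurableSet_Ioi]
      rfl
    · simp [hf_def, hi]
  have hfV : ∀ i, Var[f i; Measure.pi fun _ : Fin n => gaussianReal (μ i) 1] ≤
      if μ i = 0 then p else 0 := by
    intro i
    refine (variance_le_expectation_sq (hfL i).aestronglyMeasurable).trans ?_
    rw [← hfI i]
    refine le_of_eq (integral_congr_ae (Eventually.of_forall fun x => ?_))
    by_cases hi : μ i = 0
    · by_cases hx : x ∈ A <;> simp [hf_def, hi, hx]
    · simp [hf_def, hi]
  have hsum : ∑ i, (if μ i = 0 then p else 0) = E := by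
    rw [← Finset.sum_filter, Finset.sum_const, nsmul_eq_mul]
  have h := pi_chebyshev hfL (half_pos hpos)
  simp only [hfI, hsum] at h
  refine (measureReal_mono (fun X hX => ?_)).trans (h.trans ?_)
  · have hX : (({i | q < sumSq (X i)} : Finset (Fin m)).card : ℝ) ≤ E / 2 := hX
    have hle : ∑ i, f i (X i) ≤ (({i | q < sumSq (X i)} : Finset (Fin m)).card : ℝ) := by
      rw [Finset.card_filter]
      push_cast
      refine Finset.sum_le_sum fun i _ => ?_
      by_cases hi : μ i = 0
      · simp [hf_def, hi, hA_def, Set.indicator_apply]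
      · simp only [hf_def, hi, if_false, Pi.zero_apply]
        positivity
    change E / 2 ≤ |∑ i, f i (X i) - E|
    rw [abs_sub_comm]
    exact le_trans (by linarith) (le_abs_self _)
  · have hV : ∑ i, Var[f i; Measure.pi fun _ : Fin n => gaussianReal (μ i) 1] ≤ E :=
      (Finset.sum_le_sum fun i _ => hfV i).trans_eq hsum
    calc _ ≤ E / (E / 2) ^ 2 := by gcongr
      _ = 4 / E := by field_simp; norm_num

end Count

/-! ### Critical values along a sequence of problems -/

/-- Turns comparisons of `μ₁²` with the boundary into strict comparisons of chi-squared rates. -/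
theorem sub_log_strictMonoOn :
    StrictMonoOn (fun t : ℝ => t - Real.log (1 + t)) (Set.Ici 0) := by
  intro s hs t _ hst
  have hs : (0 : ℝ) ≤ s := hs
  have h1 : Real.log ((1 + t) / (1 + s)) < (1 + t) / (1 + s) - 1 := by
    refine Real.log_lt_sub_one_of_pos (div_pos (by linarith) (by linarith)) ?_
    rw [ne_eq, div_eq_one_iff_eq (by linarith)]
    linarith
  rw [Real.log_div (by linarith) (by linarith)] at h1
  have h2 : (1 + t) / (1 + s) - 1 ≤ t - s := by
    rw [div_sub_one (by linarith), div_le_iff₀ (by linarith)]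
    nlinarith
  simp only
  linarith

section Asymptotics

variable {M N : ℕ → ℕ} {d : ℝ}

theorem tendsto_log_natCast (hM : Tendsto M atTop atTop) :
    Tendsto (fun k => Real.log (M k)) atTop atTop :=
  Real.tendsto_log_atTop.comp (tendsto_natCast_atTop_atTop.comp hM)

theorem tendsto_sampleSize (hM : Tendsto M atTop atTop) (hN : ∀ k, 0 < N k)
    (hd : Tendsto (fun k => Real.log (M k) / N k) atTop (𝓝 d)) : Tendsto N atTop atTop := by
  rw [← tendsto_natCast_atTop_iff (R := ℝ)]
  have hpos : 0 < max d 0 + 1 := by positivity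
  refine tendsto_atTop_mono' _ ?_ ((tendsto_log_natCast hM).atTop_div_const hpos)
  filter_upwards [hd.eventually_le_const
    (show d < max d 0 + 1 by linarith [le_max_left d 0])] with k hk
  have hNk : (0 : ℝ) < N k := by exact_mod_cast hN k
  rw [div_le_iff₀ hNk] at hk
  rw [div_le_iff₀ hpos]
  linarith

/-- The change of scale: `m ^ b` is `exp (n (b d + o(1)))`, and constant factors do not matter
because `n → ∞`. -/
theorem eventually_mul_log_add_le (hN : Tendsto N atTop atTop)
    (hd : Tendsto (fun k => Real.log (M k) / N k) atTop (𝓝 d)) {b r : ℝ} (h : b * d < r)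
    (c : ℝ) : ∀ᶠ k in atTop, b * Real.log (M k) + c ≤ N k * r := by
  have hN' : Tendsto (fun k => (N k : ℝ)) atTop atTop := tendsto_natCast_atTop_atTop.comp hN
  have h1 : Tendsto (fun k => b * (Real.log (M k) / N k) + c / N k) atTop (𝓝 (b * d + 0)) :=
    (hd.const_mul b).add (tendsto_const_nhds.div_atTop hN')
  rw [add_zero] at h1
  filter_upwards [h1.eventually_le_const h, hN'.eventually_gt_atTop 0] with k hk hk0
  have : b * (Real.log (M k) / N k) + c / N k = (b * Real.log (M k) + c) / N k := by ring
  rw [this, div_le_iff₀ hk0] at hk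
  linarith

theorem rpow_eq_exp_log {m : ℕ} (hm : 0 < m) (s : ℝ) :
    (m : ℝ) ^ s = Real.exp (s * Real.log m) := by
  rw [Real.rpow_def_of_pos (by exact_mod_cast hm), mul_comm]

theorem eventually_quantile_chiSquared_le (hM : Tendsto M atTop atTop)
    (hN : Tendsto N atTop atTop)
    (hd : Tendsto (fun k => Real.log (M k) / N k) atTop (𝓝 d)) {γ δ : ℝ} (hδ : 0 ≤ δ)
    (h : (1 - γ) * d < (δ - Real.log (1 + δ)) / 2) :
    ∀ᶠ k in atTop,
      quantile (chiSquared (N k)) (1 - (M k : ℝ) ^ (γ - 1)) ≤ N k * (1 + δ) := by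
  filter_upwards [eventually_mul_log_add_le hN hd h 0, hM.eventually_gt_atTop 0] with k hk hMk
  refine quantile_le (by positivity)
    ((chiSquared_Ioi_le (by linarith) (N k)).trans ?_)
  rw [rpow_eq_exp_log hMk, sub_sub_cancel]
  refine Real.exp_le_exp.2 ?_
  rw [show 1 + δ - 1 - Real.log (1 + δ) = δ - Real.log (1 + δ) by ring]
  linarith

theorem eventually_le_quantile_chiSquared (hM : Tendsto M atTop atTop)
    (hN : Tendsto N atTop atTop)
    (hd : Tendsto (fun k => Real.log (M k) / N k) atTop (𝓝 d)) {γ δ : ℝ} (hδ : 0 ≤ δ)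
    (h : (δ - Real.log (1 + δ)) / 2 < (1 - γ) * d) :
    ∀ᶠ k in atTop,
      N k * (1 + δ) ≤ quantile (chiSquared (N k)) (1 - (M k : ℝ) ^ (γ - 1)) := by
  obtain ⟨r, hr1, hr2⟩ := exists_between h
  have hlow := hN.eventually (eventually_le_chiSquared_Ioi (v := 1 + δ) (r := r) (by linarith)
    (by rwa [show 1 + δ - 1 - Real.log (1 + δ) = δ - Real.log (1 + δ) by ring]))
  -- The additive `1` makes the tail comparison strict, as `le_quantile` requires.
  filter_upwards [eventually_mul_log_add_le hN hd (b := -(1 - γ)) (r := -r) (by linarith) 1,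
    hM.eventually_gt_atTop 0, hlow] with k hk hMk hlk
  rw [rpow_eq_exp_log hMk]
  refine le_quantile (by linarith [Real.exp_pos ((γ - 1) * Real.log (M k))]) ?_
  rw [sub_sub_cancel]
  refine lt_of_lt_of_le (Real.exp_lt_exp.2 ?_) hlk
  linarith

/-- Uniformity in `β` is needed because the level `α / (2 |Ŝ|)` is random. -/
theorem eventually_quantile_studentT_le (hM : Tendsto M atTop atTop)
    (hN : Tendsto N atTop atTop)
    (hd : Tendsto (fun k => Real.log (M k) / N k) atTop (𝓝 d)) {κ x : ℝ} (hx : 0 ≤ x)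
    (h : κ * d < Real.log (1 + x ^ 2) / 2) {C : ℝ} (hC : 0 < C) :
    ∀ᶠ k in atTop, ∀ β : ℝ, C * (M k : ℝ) ^ (-κ) ≤ β →
      quantile (studentT (N k - 1)) (1 - β) ≤ √(N k) * x := by
  -- The second constant compensates for `n - 1` degrees of freedom in place of `n`.
  filter_upwards [eventually_mul_log_add_le hN hd h
    (-Real.log C + Real.log (1 + x ^ 2) / 2), hM.eventually_gt_atTop 0,
    hN.eventually_gt_atTop 1] with k hk hMk hNk β hβ
  have hcast : ((N k - 1 : ℕ) : ℝ) + 1 = N k := by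
    rw [Nat.cast_sub hNk.le]; simp
  refine quantile_le (by positivity) ?_
  have ht := studentT_Ioi_le (k := N k - 1) (by omega) hx
  rw [hcast] at ht
  rw [sub_sub_cancel]
  refine ht.trans (le_trans ?_ hβ)
  rw [rpow_eq_exp_log hMk]
  nth_rewrite 1 [← Real.exp_log hC]
  rw [← Real.exp_add]
  refine Real.exp_le_exp.2 ?_
  rw [show ((N k - 1 : ℕ) : ℝ) = N k - 1 by linarith]
  linarith

theorem eventually_le_quantile_studentT (hM : Tendsto M atTop atTop)
    (hN : Tendsto N atTop atTop)
    (hd : Tendsto (fun k => Real.log (M k) / N k) atTop (𝓝 d)) {κ x : ℝ} (hx : 0 ≤ x)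
    (h : Real.log (1 + x ^ 2) / 2 < κ * d) {C : ℝ} (hC : 0 < C) :
    ∀ᶠ k in atTop, ∀ β : ℝ, 0 < β → β ≤ C * (M k : ℝ) ^ (-κ) →
      √(N k) * x ≤ quantile (studentT (N k - 1)) (1 - β) := by
  obtain ⟨r, hr1, hr2⟩ := exists_between h
  have hlow := ((tendsto_sub_atTop_nat 1).comp hN).eventually
    (eventually_le_studentT_Ioi hx hr1)
  filter_upwards [eventually_mul_log_add_le hN hd (b := -κ) (r := -r) (by linarith)
    (Real.log C + 1 + -r), hM.eventually_gt_atTop 0, hN.eventually_gt_atTop 1, hlow]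
    with k hk hMk hNk hlk β hβ0 hβ
  simp only [Function.comp] at hlk
  have hcast : ((N k - 1 : ℕ) : ℝ) + 1 = N k := by
    rw [Nat.cast_sub hNk.le]; simp
  rw [hcast] at hlk
  refine le_quantile (by linarith) ?_
  rw [sub_sub_cancel]
  refine lt_of_lt_of_le (hβ.trans_lt ?_) hlk
  rw [rpow_eq_exp_log hMk]
  nth_rewrite 1 [← Real.exp_log hC]
  rw [← Real.exp_add]
  refine Real.exp_lt_exp.2 ?_
  rw [show ((N k - 1 : ℕ) : ℝ) = N k - 1 by linarith]
  linarith

/-! ### The number of selected hypotheses along a sequence -/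

theorem tendsto_natCast_rpow_neg (hM : Tendsto M atTop atTop) {s : ℝ} (hs : 0 < s) :
    Tendsto (fun k => (M k : ℝ) ^ (-s)) atTop (𝓝 0) :=
  (tendsto_rpow_neg_atTop hs).comp (tendsto_natCast_atTop_atTop.comp hM)

theorem one_sub_rpow_mem {m : ℕ} (hm : 0 < m) {γ : ℝ} (hγ : γ ≤ 1) :
    1 - (m : ℝ) ^ (γ - 1) ∈ Set.Ico (0 : ℝ) 1 := by
  have h1 : (1 : ℝ) ≤ m := by exact_mod_cast hm
  have h2 : (m : ℝ) ^ (γ - 1) ≤ 1 := Real.rpow_le_one_of_one_le_of_nonpos h1 (by linarith)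
  have h3 : 0 < (m : ℝ) ^ (γ - 1) := Real.rpow_pos_of_pos (by linarith) _
  exact ⟨by linarith, by linarith⟩

theorem natCast_mul_rpow {m : ℕ} (hm : 0 < m) (γ : ℝ) :
    (m : ℝ) * (m : ℝ) ^ (γ - 1) = (m : ℝ) ^ γ := by
  have h1 : (0 : ℝ) < m := by exact_mod_cast hm
  rw [Real.rpow_sub_one h1.ne']
  field_simp

/-- The expected count is at most `m ^ γ + C m ^ (1 - ε) ≤ (1 + C) m ^ γ`; the last step is where `ε
+ γ ≥ 1` enters. -/
theorem tendsto_card_selected_ge (hM : Tendsto M atTop atTop)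
    (μ : (k : ℕ) → Fin (M k) → ℝ) {ε γ κ : ℝ}
    (hO : (fun k => (({i | μ k i ≠ 0} : Finset (Fin (M k))).card : ℝ))
      =O[atTop] fun k => (M k : ℝ) ^ (1 - ε))
    (hγ : γ ≤ 1) (hεγ : 1 ≤ ε + γ) (hκ : γ < κ) :
    Tendsto (fun k => (dataLaw (N k) (μ k)).real
      {X | (M k : ℝ) ^ κ ≤ (selected γ X).card}) atTop (𝓝 0) := by
  obtain ⟨C, hC⟩ := hO.bound
  have hlim := (tendsto_natCast_rpow_neg hM (sub_pos.2 hκ)).const_mul (1 + C)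
  rw [mul_zero] at hlim
  refine squeeze_zero' (Eventually.of_forall fun k => measureReal_nonneg) ?_ hlim
  filter_upwards [hC, hM.eventually_gt_atTop 0] with k hk hMk
  have hM0 : (0 : ℝ) < M k := by exact_mod_cast hMk
  have hM1 : (1 : ℝ) ≤ M k := by exact_mod_cast hMk
  refine (dataLaw_card_le (μ k) _ (Real.rpow_pos_of_pos hM0 κ)).trans ?_
  rw [Real.norm_of_nonneg (by positivity), Real.norm_of_nonneg (by positivity)] at hk
  have hq := real_Ioi_quantile_le (ν := chiSquared (N k)) (one_sub_rpow_mem hMk hγ).2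
  rw [sub_sub_cancel] at hq
  have hq' := (mul_le_mul_of_nonneg_left hq hM0.le).trans_eq (natCast_mul_rpow hMk γ)
  have hC0 : 0 ≤ C := by
    by_contra hC0
    have : C * (M k : ℝ) ^ (1 - ε) < 0 :=
      mul_neg_of_neg_of_pos (not_le.1 hC0) (Real.rpow_pos_of_pos hM0 _)
    have : (0 : ℝ) ≤ (({i | μ k i ≠ 0} : Finset (Fin (M k))).card : ℝ) := by positivity
    linarith
  have hε : (M k : ℝ) ^ (1 - ε) ≤ (M k : ℝ) ^ γ :=
    Real.rpow_le_rpow_of_exponent_le hM1 (by linarith)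
  have hsplit : (M k : ℝ) ^ (-(κ - γ)) = (M k : ℝ) ^ γ / (M k : ℝ) ^ κ := by
    rw [← Real.rpow_sub hM0]; congr 1; ring
  rw [hsplit, ← mul_div_assoc]
  gcongr
  nlinarith

/-- Since `m ^ (1 - ε) = o(m)`, eventually at least `m / 2` hypotheses are true. Each is selected
with probability at least `m ^ (γ - 1)`, so their expected number is at least `m ^ γ / 2`. -/
theorem tendsto_card_selected_le (hM : Tendsto M atTop atTop) (hN : ∀ k, 0 < N k)
    (μ : (k : ℕ) → Fin (M k) → ℝ) {ε γ : ℝ}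
    (hO : (fun k => (({i | μ k i ≠ 0} : Finset (Fin (M k))).card : ℝ))
      =O[atTop] fun k => (M k : ℝ) ^ (1 - ε))
    (hε : 0 < ε) (hγ0 : 0 < γ) (hγ : γ ≤ 1) :
    Tendsto (fun k => (dataLaw (N k) (μ k)).real
      {X | ((selected γ X).card : ℝ) ≤ (M k : ℝ) ^ γ / 4}) atTop (𝓝 0) := by
  obtain ⟨C, hC⟩ := hO.bound
  have hlim := (tendsto_natCast_rpow_neg hM hγ0).const_mul 8
  rw [mul_zero] at hlim
  have hsmall := (tendsto_natCast_rpow_neg hM hε).const_mul C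
  rw [mul_zero] at hsmall
  refine squeeze_zero' (Eventually.of_forall fun k => measureReal_nonneg) ?_ hlim
  filter_upwards [hC, hM.eventually_gt_atTop 0,
    hsmall.eventually_le_const (show (0 : ℝ) < 1 / 2 by norm_num)] with k hk hMk hs
  have hM0 : (0 : ℝ) < M k := by exact_mod_cast hMk
  rw [Real.norm_of_nonneg (by positivity), Real.norm_of_nonneg (by positivity)] at hk
  have hγpos : 0 < (M k : ℝ) ^ γ := Real.rpow_pos_of_pos hM0 γ
  have := nullSingletonClass_chiSquared (hN k)
  have hq := le_real_Ioi_quantile (ν := chiSquared (N k)) (chiSquared_real_Ioi_zero (hN k))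
    (one_sub_rpow_mem hMk hγ).1
  rw [sub_sub_cancel] at hq
  have hsplit : (M k : ℝ) ^ (1 - ε) = M k * (M k : ℝ) ^ (-ε) := by
    rw [sub_eq_add_neg, Real.rpow_add hM0, Real.rpow_one]
  have hnull : (M k : ℝ) / 2 ≤ (({i | μ k i = 0} : Finset (Fin (M k))).card : ℝ) := by
    have h1 := Finset.card_filter_add_card_filter_not (s := (Finset.univ : Finset (Fin (M k))))
      (fun i => μ k i = 0)
    rw [Finset.card_univ, Fintype.card_fin] at h1
    have h2 : (({i | μ k i = 0} : Finset (Fin (M k))).card : ℝ) +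
        (({i | μ k i ≠ 0} : Finset (Fin (M k))).card : ℝ) = M k := by exact_mod_cast h1
    rw [hsplit] at hk
    nlinarith
  set q := quantile (chiSquared (N k)) (1 - (M k : ℝ) ^ (γ - 1)) with hq_def
  have hE : (M k : ℝ) ^ γ / 2 ≤ (({i | μ k i = 0} : Finset (Fin (M k))).card : ℝ) *
      (chiSquared (N k)).real (Set.Ioi q) := by
    rw [← natCast_mul_rpow hMk, mul_div_right_comm]
    exact mul_le_mul hnull hq (by positivity) (by positivity)
  have hcount := dataLaw_card_ge (n := N k) (μ k) q (by linarith)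
  refine (measureReal_mono fun X hX => ?_).trans (hcount.trans ?_)
  · have hX : ((selected γ X).card : ℝ) ≤ (M k : ℝ) ^ γ / 4 := hX
    exact le_trans hX (by linarith)
  · rw [Real.rpow_neg hM0.le]
    calc _ ≤ 4 / ((M k : ℝ) ^ γ / 2) := by gcongr
      _ = _ := by field_simp; norm_num

/-! ### The power of the procedure at a fixed hypothesis -/

variable {γ α μ₁ : ℝ} {μ : (k : ℕ) → Fin (M k) → ℝ} {i : (k : ℕ) → Fin (M k)}

theorem tendsto_dataLaw_row (hi : ∀ k, μ k (i k) = μ₁) (hN : Tendsto N atTop atTop)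
    {A : (n : ℕ) → Set (Fin n → ℝ)}
    (h : Tendsto (fun n => (Measure.pi fun _ : Fin n => gaussianReal μ₁ 1).real (A n))
      atTop (𝓝 0)) :
    Tendsto (fun k => (dataLaw (N k) (μ k)).real {X | X (i k) ∈ A (N k)}) atTop (𝓝 0) := by
  refine squeeze_zero (fun k => measureReal_nonneg) (fun k => ?_) (h.comp hN)
  refine (dataLaw_real_row_le (μ k) (i k) (A (N k))).trans_eq ?_
  rw [hi k]
  rfl

theorem lt_abs_tStat_iff {n : ℕ} (hn : 0 < n) {w : ℝ} (hw : 0 ≤ w) (x : Fin n → ℝ) :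
    √n * √w < |tStat x| ↔ w < tStat x ^ 2 / n := by
  have hn' : (0 : ℝ) < n := by exact_mod_cast hn
  rw [← Real.sqrt_mul hn'.le, ← Real.sqrt_sq_eq_abs, Real.sqrt_lt_sqrt_iff (by positivity),
    lt_div_iff₀ hn', mul_comm]

theorem tendsto_rejectProb_one (hM : Tendsto M atTop atTop) (hN : Tendsto N atTop atTop)
    (hd : Tendsto (fun k => Real.log (M k) / N k) atTop (𝓝 d)) (hd0 : 0 ≤ d)
    (hi : ∀ k, μ k (i k) = μ₁) {ε : ℝ}
    (hO : (fun k => (({i | μ k i ≠ 0} : Finset (Fin (M k))).card : ℝ))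
      =O[atTop] fun k => (M k : ℝ) ^ (1 - ε))
    (hγ : γ ≤ 1) (hεγ : 1 ≤ ε + γ) (hα : 0 < α) (hγ0 : 0 < γ)
    (hμ : boundary γ d < μ₁ ^ 2) :
    Tendsto (fun k => rejectProb (N k) (μ k) γ α (i k)) atTop (𝓝 1) := by
  obtain ⟨hb1, hb2⟩ := max_lt_iff.1 hμ
  have hD : 0 ≤ (1 - γ) * d := mul_nonneg (by linarith) hd0
  obtain ⟨hδ0, hδ⟩ := boundary_right_spec hD
  obtain ⟨δ, hδ1, hδ2⟩ := exists_between hb2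
  have hδpos : 0 ≤ δ := hδ0.trans hδ1.le
  have hrate := sub_log_strictMonoOn hδ0 hδpos hδ1
  simp only [hδ] at hrate
  obtain ⟨w, hw1, hw2⟩ := exists_between hb1
  have hw0 : 0 ≤ w := by
    have : 1 ≤ Real.exp (2 * γ * d) := Real.one_le_exp (by positivity)
    linarith
  have hgap : 0 < Real.log (1 + w) / 2 - γ * d := by
    have : 2 * γ * d < Real.log (1 + w) := (Real.lt_log_iff_exp_lt (by linarith)).2 (by linarith)
    linarith
  -- `κ > γ` leaves room for the count, while `κ d` stays below the Student rate; dividing by `d +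
  -- 1` covers `d = 0`.
  obtain ⟨κ, hκ, hκd⟩ : ∃ κ, γ < κ ∧ κ * d < Real.log (1 + w) / 2 := by
    refine ⟨γ + (Real.log (1 + w) / 2 - γ * d) / (d + 1),
      lt_add_of_pos_right _ (by positivity), ?_⟩
    have : (Real.log (1 + w) / 2 - γ * d) / (d + 1) * d < Real.log (1 + w) / 2 - γ * d := by
      rw [div_mul_eq_mul_div, div_lt_iff₀ (by linarith)]
      nlinarith
    linarith
  have hwsq : √w ^ 2 = w := Real.sq_sqrt hw0
  have hsum := ((tendsto_dataLaw_row hi hN (tendsto_sumSq μ₁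
      (Ioi_mem_nhds (show 1 + δ < 1 + μ₁ ^ 2 by linarith)))).add
    (tendsto_card_selected_ge (N := N) hM μ hO hγ hεγ hκ)).add
    (tendsto_dataLaw_row hi hN (tendsto_tStat μ₁ (Ioi_mem_nhds hw2)))
  have hlim := hsum.const_sub 1
  simp only [add_zero, sub_zero] at hlim
  refine tendsto_of_tendsto_of_tendsto_of_le_of_le' hlim tendsto_const_nhds ?_
    (Eventually.of_forall fun k => measureReal_le_one)
  filter_upwards [eventually_quantile_chiSquared_le hM hN hd (γ := γ) hδpos (by linarith),
    eventually_quantile_studentT_le hM hN hd (Real.sqrt_nonneg w) (by rwa [hwsq]) (half_pos hα),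
    hM.eventually_gt_atTop 0, hN.eventually_gt_atTop 0] with k hchi ht hMk hNk
  have hM0 : (0 : ℝ) < M k := by exact_mod_cast hMk
  have hN0 : (0 : ℝ) < N k := by exact_mod_cast hNk
  rw [sub_le_iff_le_add]
  -- Covering the whole space by rejection and three bad events avoids complements, hence
  -- measurability of the rejection event.
  have hcover : (Set.univ : Set (Fin (M k) → Fin (N k) → ℝ)) ⊆
      {X | Rejects γ α X (i k)} ∪ (({X | X (i k) ∈ {x | sumSq x / (N k) ∉ Set.Ioi (1 + δ)}} ∪
        {X | (M k : ℝ) ^ κ ≤ (selected γ X).card}) ∪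
        {X | X (i k) ∈ {x | tStat x ^ 2 / (N k) ∉ Set.Ioi w}}) := by
    intro X _
    by_contra hX
    simp only [Set.mem_union, Set.mem_ofPred_eq, not_or, not_not, Set.mem_Ioi, not_le] at hX
    obtain ⟨hrej, ⟨hS, hcard⟩, hT⟩ := hX
    rw [lt_div_iff₀ hN0] at hS
    have hsel : i k ∈ selected γ X := by
      simp only [selected, Finset.mem_filter, Finset.mem_univ, true_and]
      linarith
    refine hrej ⟨hsel, lt_of_le_of_lt (ht _ ?_) ((lt_abs_tStat_iff hNk hw0 _).2 hT)⟩
    -- With an empty selection the level would be `α / 0 = 0` and the lower bound on it would fail.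
    have hc : (0 : ℝ) < (selected γ X).card := by
      exact_mod_cast Finset.card_pos.2 ⟨_, hsel⟩
    rw [Real.rpow_neg hM0.le, ← div_eq_mul_inv, div_div]
    gcongr
  have h1 := measureReal_mono (μ := dataLaw (N k) (μ k)) hcover
  rw [probReal_univ] at h1
  refine h1.trans ((measureReal_union_le _ _).trans ?_)
  exact add_le_add le_rfl ((measureReal_union_le _ _).trans
    (add_le_add (measureReal_union_le _ _) le_rfl))

/-- One failing stage suffices: below the first term the `t`-test fails, below the second the
selection. Only a lower bound on the count is needed, so `ε + γ ≥ 1` plays no role. -/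
theorem tendsto_rejectProb_zero (hM : Tendsto M atTop atTop) (hN : Tendsto N atTop atTop)
    (hNpos : ∀ k, 0 < N k)
    (hd : Tendsto (fun k => Real.log (M k) / N k) atTop (𝓝 d)) (hd0 : 0 ≤ d)
    (hi : ∀ k, μ k (i k) = μ₁) {ε : ℝ}
    (hO : (fun k => (({i | μ k i ≠ 0} : Finset (Fin (M k))).card : ℝ))
      =O[atTop] fun k => (M k : ℝ) ^ (1 - ε))
    (hε : 0 < ε) (hγ0 : 0 < γ) (hγ : γ ≤ 1) (hα : 0 < α)
    (hμ : μ₁ ^ 2 < boundary γ d) :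
    Tendsto (fun k => rejectProb (N k) (μ k) γ α (i k)) atTop (𝓝 0) := by
  rcases lt_max_iff.1 hμ with hb | hb
  · obtain ⟨w, hw1, hw2⟩ := exists_between hb
    have hw0 : 0 ≤ w := (sq_nonneg μ₁).trans hw1.le
    have hrate : Real.log (1 + √w ^ 2) / 2 < γ * d := by
      rw [Real.sq_sqrt hw0]
      have : Real.log (1 + w) < 2 * γ * d :=
        (Real.log_lt_iff_lt_exp (by linarith)).2 (by linarith)
      linarith
    have hsum := (tendsto_card_selected_le hM hNpos μ hO hε hγ0 hγ).add
      (tendsto_dataLaw_row hi hN (tendsto_tStat μ₁ (Iio_mem_nhds hw1)))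
    rw [add_zero] at hsum
    refine squeeze_zero' (Eventually.of_forall fun k => measureReal_nonneg) ?_ hsum
    -- More than `m ^ γ / 4` selected hypotheses make the level less than `2 α m ^ (-γ)`.
    filter_upwards [eventually_le_quantile_studentT hM hN hd (Real.sqrt_nonneg w) hrate
      (show 0 < 2 * α by linarith), hM.eventually_gt_atTop 0] with k ht hMk
    have hM0 : (0 : ℝ) < M k := by exact_mod_cast hMk
    have hMγ : 0 < (M k : ℝ) ^ γ := Real.rpow_pos_of_pos hM0 γ
    refine le_trans (measureReal_mono fun X hX => ?_) (measureReal_union_le _ _)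
    obtain ⟨-, hX⟩ : Rejects γ α X (i k) := hX
    by_contra hbad
    simp only [Set.mem_union, Set.mem_ofPred_eq, not_or, not_not, Set.mem_Iio, not_le] at hbad
    obtain ⟨hcard, hT⟩ := hbad
    have hc : (0 : ℝ) < (selected γ X).card := by linarith
    refine lt_asymm hT ((lt_abs_tStat_iff (hNpos k) hw0 _).1 (lt_of_le_of_lt (ht _ ?_ ?_) hX))
    · positivity
    · rw [Real.rpow_neg hM0.le, ← div_eq_mul_inv, div_le_div_iff₀ (by positivity) hMγ]
      nlinarith
  · have hD : 0 ≤ (1 - γ) * d := mul_nonneg (by linarith) hd0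
    obtain ⟨hδ0, hδ⟩ := boundary_right_spec hD
    obtain ⟨δ, hδ1, hδ2⟩ := exists_between hb
    have hδpos : 0 ≤ δ := (sq_nonneg μ₁).trans hδ1.le
    have hrate := sub_log_strictMonoOn hδpos hδ0 hδ2
    simp only [hδ] at hrate
    refine squeeze_zero' (Eventually.of_forall fun k => measureReal_nonneg) ?_
      (tendsto_dataLaw_row hi hN (tendsto_sumSq μ₁
        (Iio_mem_nhds (show 1 + μ₁ ^ 2 < 1 + δ by linarith))))
    filter_upwards [eventually_le_quantile_chiSquared hM hN hd (γ := γ) hδpos (by linarith)]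
      with k hchi
    have hN0 : (0 : ℝ) < N k := by exact_mod_cast hNpos k
    refine measureReal_mono fun X hX => ?_
    obtain ⟨hX, -⟩ : Rejects γ α X (i k) := hX
    simp only [selected, Finset.mem_filter, Finset.mem_univ, true_and] at hX
    simp only [Set.mem_ofPred_eq, Set.mem_Iio, not_lt]
    rw [le_div_iff₀ hN0]
    linarith

end Asymptotics

end TwoStage

theorem theorem4p1
    (γ : ℝ) (hγ0 : 0 < γ) (hγ1 : γ ≤ 1)
    (α : ℝ) (hα0 : 0 < α) (hα1 : α < 1)
    (d : ℝ) (hd : 0 ≤ d)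
    (n : ℕ → ℕ) (hn : ∀ m, 0 < n m)
    (hA : Tendsto (fun m : ℕ => Real.log m / n m) atTop (𝓝 d))
    (ε : ℝ) (hε0 : 0 < ε) (hε1 : ε ≤ 1)
    (μ : (m : ℕ) → Fin m → ℝ)
    (hsparse : (fun m : ℕ => (({i | μ m i ≠ 0} : Finset (Fin m)).card : ℝ))
      =Θ[atTop] fun m : ℕ => (m : ℝ) ^ (1 - ε))
    (μ₁ : ℝ) (hμ₁ : μ₁ ≠ 0) (hμ : ∀ m, μ (m + 1) 0 = μ₁) :
    (TwoStage.cStar γ d ∈ Set.Ioc 0 2 ∧ TwoStage.a (TwoStage.cStar γ d) = (1 - γ) * d ∧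
      ∀ c ∈ Set.Ioc (0 : ℝ) 2, TwoStage.a c = (1 - γ) * d → c = TwoStage.cStar γ d) ∧
    (1 ≤ ε + γ → TwoStage.boundary γ d < μ₁ ^ 2 →
      Tendsto (fun m : ℕ => TwoStage.rejectProb (n (m + 1)) (μ (m + 1)) γ α 0) atTop (𝓝 1)) ∧
    (μ₁ ^ 2 < TwoStage.boundary γ d →
      Tendsto (fun m : ℕ => TwoStage.rejectProb (n (m + 1)) (μ (m + 1)) γ α 0) atTop (𝓝 0)) := by
  -- The shift to `m + 1` provides the index `0 : Fin (m + 1)` of the fixed hypothesis.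
  have hM := tendsto_add_atTop_nat 1
  have hA' := hA.comp hM
  have hO := hsparse.isBigO.comp_tendsto hM
  have hN := TwoStage.tendsto_sampleSize hM (fun m => hn (m + 1)) hA'
  refine ⟨?_, fun hεγ hb => ?_, fun hb => ?_⟩
  · obtain ⟨hc, ha⟩ := TwoStage.cStar_spec (γ := γ) (mul_nonneg (sub_nonneg.2 hγ1) hd)
    exact ⟨hc, ha, fun c hc' hac => TwoStage.a_injOn hc' hc (hac.trans ha.symm)⟩
  · exact TwoStage.tendsto_rejectProb_one (M := fun m => m + 1) (N := fun m => n (m + 1))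
      (μ := fun m => μ (m + 1)) (i := fun _ => 0) hM hN hA' hd hμ hO hγ1 hεγ hα0 hγ0 hb
  · exact TwoStage.tendsto_rejectProb_zero (M := fun m => m + 1) (N := fun m => n (m + 1))
      (μ := fun m => μ (m + 1)) (i := fun _ => 0) hM hN (fun m => hn (m + 1)) hA' hd hμ hO
      hε0 hγ0 hγ1 hα0 hb
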